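/- Let $M$ be a closed connected surface with a finite (simplicial) triangulation $\mathcal T=(V,E,F)$, where $V,E,F$ are the sets of vertices, edges and triangles, and let $\Phi:E\to[0,\pi/2]$ be a weight; write $\chi(M)=|V|-|E|+|F|$ and $i\sim j$ if $\{ij\}\in E$. A circle packing metric is a map $r:V\to(0,\infty)$; put $\|r\|^2=\sum_{i\in V} r_i^2$. It assigns to each edge $\{ij\}$ the length $l_{ij}=\sqrt{r_i^2+r_j^2+2r_ir_j\cos\Phi_{ij}}$, and thereby makes each triangle $\{ijk\}\in F$ a Euclidean triangle; let $\theta_i^{jk}$ be its inner angle at $i$. Put $$K_i=2\pi-\sum_{\{ijk\}\in F}\theta_i^{jk},\qquad R_i=\frac{K_i}{r_i^2},\qquad R_{av}=\frac{2\pi\chi(M)}{\|r\|^2},\qquad u_i=\ln r_i^2,$$ where the sum is over the triangles with vertex $i$. The discrete Laplacian of $r$ acts on functions $f:V\to\mathbb R$ by $$\Delta f_i=\frac1{r_i^2}\sum_{j\sim i}\Big(-\frac{\partial K_i}{\partial u_j}\Big)(f_j-f_i).$$ The normalized combinatorial Ricci flow is the system $$\frac{d(r_i^2)}{dt}=(R_{av}-R_i)\,r_i^2,\qquad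 i\in V.$$ Theorem. Let $r^*$ be a circle packing metric of constant $R$-curvature (all $R_i$ are equal), and suppose that the smallest positive eigenvalue $\lambda_1$ of $-\Delta$ at $r^*$ satisfies $$\lambda_1>\frac{2\pi\chi(M)}{\|r^*\|^2}.$$ Then there are constants $\delta,C,a>0$ such that for every circle packing metric $r_0$ with $\|r_0\|=\|r^*\|$ and $\|r_0-r^*\|^2<\delta$, the normalized combinatorial Ricci flow has a solution $r(t)$ with $r(0)=r_0$ which exists for all $t\in[0,\infty)$, which agrees with every other solution with initial value $r_0$ on any interval $[0,b)$ where the latter is defined, and which converges exponentially fast to $r^*$: $$\|r(t)-r^*\|\le C e^{-at}\qquad\text{for all } t\ge 0.$$ -/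

import Mathlib

/-- The graph formed by the vertices and edges of a simplicial complex. -/
def skeletonGraph {V : Type*} [DecidableEq V] (K : AbstractSimplicialComplex V) :
    SimpleGraph V where
  Adj i j := i ≠ j ∧ ({i, j} : Finset V) ∈ K
  symm := ⟨fun i j h => ⟨h.1.symm, by rw [Finset.pair_comm]; exact h.2⟩⟩
  loopless := ⟨fun _ h => h.1 rfl⟩

/-- `i`, `j`, `k` are the three distinct vertices of a triangle of the complex. -/
def IsTriangle {V : Type*} [DecidableEq V] (K : AbstractSimplicialComplex V) (i j k : V) : Prop :=
  i ≠ j ∧ j ≠ k ∧ i ≠ k ∧ ({i, j, k} : Finset V) ∈ K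

/-- The link of the vertex `v` in a two-dimensional complex, as a graph: its vertices are the
neighbours of `v`, and two of them are joined when they form a triangle with `v`. -/
def vertexLink {V : Type*} [DecidableEq V] (K : AbstractSimplicialComplex V) (v : V) :
    SimpleGraph {w : V // (skeletonGraph K).Adj v w} where
  Adj a b := IsTriangle K v a b
  symm := ⟨fun a b h => ⟨h.2.2.1, h.2.1.symm, h.1, by
    rw [show ({v, b.1, a.1} : Finset V) = {v, a.1, b.1} by rw [Finset.pair_comm]]
    exact h.2.2.2⟩⟩
  loopless := ⟨fun _ h => h.2.1 rfl⟩

/-- A weighted triangulation of a closed connected surface: a finite two-dimensional simplicial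
complex in which every edge lies in exactly two triangles and every vertex link is connected
(so that every vertex link is a cycle), with connected 1-skeleton, together with a weight
in `[0, π/2]` on every edge. -/
structure WeightedTriangulatedSurface (V : Type*) [Fintype V] [DecidableEq V] where
  /-- the vertices, edges and triangles -/
  complex : AbstractSimplicialComplex V
  /-- there are no simplices of dimension greater than two -/
  card_le_three : ∀ s ∈ complex, s.card ≤ 3
  /-- every edge lies in exactly two triangles -/
  edge_in_two_triangles : ∀ e ∈ complex, e.card = 2 →
    {t : Finset V | t ∈ complex ∧ t.card = 3 ∧ e ⊆ t}.ncard = 2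
  /-- every vertex link is connected (and non-empty) -/
  link_connected : ∀ v : V, (vertexLink complex v).Connected
  /-- the surface is connected (and non-empty) -/
  connected : (skeletonGraph complex).Connected
  /-- the weight; only its values on edges matter -/
  weight : Sym2 V → ℝ
  /-- the weight of an edge lies in `[0, π/2]` -/
  weight_mem : ∀ i j : V, (skeletonGraph complex).Adj i j →
    weight s(i, j) ∈ Set.Icc (0 : ℝ) (Real.pi / 2)

/-- The squared Euclidean norm `‖x‖² = ∑ xᵢ²`. -/
noncomputable def normSq {V : Type*} [Fintype V] (x : V → ℝ) : ℝ := ∑ i, x i ^ 2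

namespace WeightedTriangulatedSurface

/-- The Euler characteristic `|V| - |E| + |F|`. -/
noncomputable def eulerChar {V : Type*} [Fintype V] [DecidableEq V]
    (T : WeightedTriangulatedSurface V) : ℤ :=
  (Fintype.card V : ℤ)
    - ({e : Finset V | e ∈ T.complex ∧ e.card = 2}.ncard : ℤ)
    + ({t : Finset V | t ∈ T.complex ∧ t.card = 3}.ncard : ℤ)

/-- The length of the edge `ij` for the circle packing metric `r`. -/
noncomputable def edgeLength {V : Type*} [Fintype V] [DecidableEq V]
    (T : WeightedTriangulatedSurface V) (r : V → ℝ) (i j : V) : ℝ :=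
  Real.sqrt (r i ^ 2 + r j ^ 2 + 2 * r i * r j * Real.cos (T.weight s(i, j)))

/-- The inner angle at `i` of the Euclidean triangle `ijk` with the given edge lengths. -/
noncomputable def innerAngle {V : Type*} [Fintype V] [DecidableEq V]
    (T : WeightedTriangulatedSurface V) (r : V → ℝ) (i j k : V) : ℝ :=
  Real.arccos ((T.edgeLength r i j ^ 2 + T.edgeLength r i k ^ 2 - T.edgeLength r j k ^ 2) /
    (2 * T.edgeLength r i j * T.edgeLength r i k))

open Classical in
/-- The angle deficit `Kᵢ`, i.e. `2π` minus the sum of the inner angles at `i` of all triangles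
with vertex `i`. The sum over ordered pairs `(j, k)` meets every triangle `ijk` twice, whence the
division by two. -/
noncomputable def angleDeficit {V : Type*} [Fintype V] [DecidableEq V]
    (T : WeightedTriangulatedSurface V) (r : V → ℝ) (i : V) : ℝ :=
  2 * Real.pi -
    (∑ j : V, ∑ k : V, if IsTriangle T.complex i j k then T.innerAngle r i j k else 0) / 2

/-- The `R`-curvature `Rᵢ = Kᵢ / rᵢ²`. -/
noncomputable def rCurvature {V : Type*} [Fintype V] [DecidableEq V]
    (T : WeightedTriangulatedSurface V) (r : V → ℝ) (i : V) : ℝ :=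
  T.angleDeficit r i / r i ^ 2

/-- The average curvature `R_av = 2πχ(M) / ‖r‖²`. -/
noncomputable def averageCurvature {V : Type*} [Fintype V] [DecidableEq V]
    (T : WeightedTriangulatedSurface V) (r : V → ℝ) : ℝ :=
  2 * Real.pi * (T.eulerChar : ℝ) / normSq r

/-- `r` is a circle packing metric of constant `R`-curvature. -/
def IsConstantRCurvatureMetric {V : Type*} [Fintype V] [DecidableEq V]
    (T : WeightedTriangulatedSurface V) (r : V → ℝ) : Prop :=
  (∀ i, 0 < r i) ∧ ∃ c : ℝ, ∀ i, T.rCurvature r i = c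

/-- The partial derivative `∂Kᵢ/∂uⱼ` at `r`, where `u = ln r²`, i.e. `r = exp (u / 2)`. -/
noncomputable def partialDeficit {V : Type*} [Fintype V] [DecidableEq V]
    (T : WeightedTriangulatedSurface V) (r : V → ℝ) (i j : V) : ℝ :=
  fderiv ℝ (fun u : V → ℝ => T.angleDeficit (fun v => Real.exp (u v / 2)) i)
    (fun v => Real.log (r v ^ 2)) (Pi.single j 1)

open Classical in
/-- The discrete Laplacian `Δfᵢ = rᵢ⁻² ∑_{j ∼ i} (-∂Kᵢ/∂uⱼ) (fⱼ - fᵢ)` of the metric `r`. -/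
noncomputable def laplacian {V : Type*} [Fintype V] [DecidableEq V]
    (T : WeightedTriangulatedSurface V) (r : V → ℝ) : (V → ℝ) →ₗ[ℝ] (V → ℝ) where
  toFun f i := 1 / r i ^ 2 *
    ∑ j : V, if (skeletonGraph T.complex).Adj i j
      then (-T.partialDeficit r i j) * (f j - f i) else 0
  map_add' f g := by
    funext i
    simp only [Pi.add_apply]
    rw [← mul_add (1 / r i ^ 2), ← Finset.sum_add_distrib]
    congr 1
    refine Finset.sum_congr rfl fun j _ => ?_
    split_ifs <;> ring
  map_smul' c f := by
    funext i
    simp only [Pi.smul_apply, smul_eq_mul, RingHom.id_apply]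
    rw [mul_left_comm c, Finset.mul_sum Finset.univ _ c]
    congr 1
    refine Finset.sum_congr rfl fun j _ => ?_
    split_ifs <;> ring

/-- `r` is a solution on the time interval `I` of the normalized combinatorial Ricci flow
`dgᵢ/dt = (R_av - Rᵢ) gᵢ`, `gᵢ = rᵢ²`, in the space of circle packing metrics. At an end point
of `I` the derivative is one-sided. -/
def IsRicciFlowOn {V : Type*} [Fintype V] [DecidableEq V]
    (T : WeightedTriangulatedSurface V) (I : Set ℝ) (r : ℝ → V → ℝ) : Prop :=
  ∀ t ∈ I, ∀ i, 0 < r t i ∧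
    HasDerivWithinAt (fun s => r s i ^ 2)
      ((T.averageCurvature (r t) - T.rCurvature (r t) i) * r t i ^ 2) I t

end WeightedTriangulatedSurface

/-! In the coordinates `u = ln r²` the flow reads `u' = R_av - R`. The Jacobian `L = ∂K/∂u` is the
Laplacian of a weighted graph: a common scaling of the radii preserves angles, the mixed derivatives
`∂θᵢ/∂uⱼ` are symmetric, and weights in `[0, π/2]` make them nonnegative. At a metric of constant
curvature `c`, Gauss-Bonnet forces `c = 2πχ/‖r*‖²`. On the tangent space `∑ r*ᵢ² wᵢ = 0` of the
level set of `‖r‖²` the flow linearizes to `Δ + c`, whose eigenvalues there are at most `c - λ₁ <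
0`.

The scaling direction is neutral for the flow, so linearized stability does not apply directly. The
remedy is `dampedField`: with `N = ‖r*‖²`, it replaces `R_av` by the constant `2πχ/N` and subtracts
`λ₁(‖r‖² - N)/N`. The Poincaré inequality `le_sum_mul_deficitDeriv` bounds its linearization by
`-(λ₁ - c)` on the whole space, for the inner product with weights `r*ᵢ²`, and
`exists_exponentially_stable` yields global, exponentially convergent solutions. By Gauss-Bonnet the
excess `‖r‖² - N` solves a scalar equation with equilibrium zero (`sum_exp_eq_of_dampedField`);
hence solutions starting on the level set stay there, where the damped field is the Ricci flow
field. Uniqueness follows from the local Lipschitz property of the original field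
(`IsRicciFlowOn.eqOn`). -/

/-! ### Integral curves of Lipschitz vector fields -/

/-- A bounded Lipschitz vector field has a global integral curve through every point. -/
theorem LipschitzWith.exists_forall_hasDerivAt_of_bounded {E : Type*} [NormedAddCommGroup E]
    [NormedSpace ℝ E] [CompleteSpace E] {f : E → E} {K L : NNReal} (hf : LipschitzWith K f)
    (hL : ∀ x, ‖f x‖ ≤ L) (x₀ : E) :
    ∃ α : ℝ → E, α 0 = x₀ ∧ ∀ t, HasDerivAt α (f (α t)) t := by
  -- A curve of speed at most `L` moves at most `L (n + 1)` in time `n + 1`, so Picard-Lindelöf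
  -- applies on each of these intervals.
  have key : ∀ n : ℕ, ∃ α : ℝ → E, α 0 = x₀ ∧
      ∀ t ∈ Set.Ioo (-(n + 1 : ℝ)) (n + 1), HasDerivAt α (f (α t)) t := by
    intro n
    have h0 : (0 : ℝ) ∈ Set.Icc (-(n + 1 : ℝ)) (n + 1) := ⟨by linarith [n.cast_nonneg (α := ℝ)],
      by positivity⟩
    have hpl : IsPicardLindelof (fun _ => f) (tmin := -(n + 1 : ℝ)) (tmax := n + 1) ⟨0, h0⟩ x₀
        (L * (n + 1)) 0 L K :=
      .of_time_independent (fun x _ => hL x) hf.lipschitzOnWith (by simp)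
    obtain ⟨α, h1, h2⟩ := hpl.exists_eq_forall_mem_Icc_hasDerivWithinAt₀
    exact ⟨α, h1, fun t ht => (h2 t (Set.Ioo_subset_Icc_self ht)).hasDerivAt
      (Icc_mem_nhds ht.1 ht.2)⟩
  choose α hα0 hα using key
  have hagree : ∀ n m : ℕ, n ≤ m → Set.EqOn (α n) (α m) (Set.Ioo (-(n + 1 : ℝ)) (n + 1)) := by
    intro n m hnm
    have hnm' : (n : ℝ) ≤ m := by exact_mod_cast hnm
    refine ODE_solution_unique_of_mem_Ioo (v := fun _ => f) (s := fun _ => Set.univ) (t₀ := 0)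
      (K := K) (fun _ _ => hf.lipschitzOnWith)
      ⟨by linarith [n.cast_nonneg (α := ℝ)], by positivity⟩
      (fun t ht => ⟨hα n t ht, trivial⟩)
      (fun t ht => ⟨hα m t ⟨by linarith [ht.1], by linarith [ht.2]⟩, trivial⟩)
      ((hα0 n).trans (hα0 m).symm)
  refine ⟨fun t => α ⌈|t|⌉₊ t, hα0 _, fun t => ?_⟩
  -- For `|s| < |t| + 1` the index `⌈|s|⌉₊` is at most `m`, so near `t` the glued curve is the
  -- single solution `α m`.
  set m := ⌈|t|⌉₊ + 1 with hm
  have hval : ∀ s, |s| < |t| + 1 → α ⌈|s|⌉₊ s = α m s := by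
    intro s hs
    refine hagree _ m ?_ ?_
    · rw [hm, Nat.ceil_le]
      push_cast
      linarith [Nat.le_ceil |t|]
    · rw [Set.mem_Ioo, ← abs_lt]
      linarith [Nat.le_ceil |s|]
  have htm : t ∈ Set.Ioo (-(m + 1 : ℝ)) (m + 1) := by
    rw [Set.mem_Ioo, ← abs_lt, hm]
    push_cast
    linarith [Nat.le_ceil |t|]
  have hev : (fun s => α ⌈|s|⌉₊ s) =ᶠ[nhds t] α m := by
    have : ∀ᶠ s in nhds t, |s| < |t| + 1 :=
      continuous_abs.continuousAt.eventually_lt continuousAt_const (by linarith)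
    filter_upwards [this] with s hs using hval s hs
  have := (hα m t htm).congr_of_eventuallyEq hev
  rwa [← hval t (by linarith)] at this

/-- Two integral curves of a locally Lipschitz vector field with the same initial value agree. -/
theorem LocallyLipschitz.eqOn_Icc_of_hasDerivWithinAt {E : Type*} [NormedAddCommGroup E]
    [NormedSpace ℝ E] {F : E → E} (hF : LocallyLipschitz F) {f g : ℝ → E} {a b : ℝ}
    (hf : ContinuousOn f (Set.Icc a b))
    (hf' : ∀ t ∈ Set.Ico a b, HasDerivWithinAt f (F (f t)) (Set.Ici t) t)
    (hg : ContinuousOn g (Set.Icc a b))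
    (hg' : ∀ t ∈ Set.Ico a b, HasDerivWithinAt g (F (g t)) (Set.Ici t) t)
    (hab : f a = g a) : Set.EqOn f g (Set.Icc a b) := by
  -- The two trajectories fill a compact set, on which the field has one Lipschitz constant.
  obtain ⟨K, hK⟩ := LocallyLipschitzOn.exists_lipschitzOnWith_of_compact
    ((isCompact_Icc.image_of_continuousOn hf).union (isCompact_Icc.image_of_continuousOn hg))
    hF.locallyLipschitzOn
  exact ODE_solution_unique_of_mem_Icc_right (v := fun _ => F) (fun _ _ => hK) hf hf'
    (fun t ht => .inl ⟨t, Set.Ico_subset_Icc_self ht, rfl⟩) hg hg'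
    (fun t ht => .inr ⟨t, Set.Ico_subset_Icc_self ht, rfl⟩) hab

/-! ### Linearized stability -/

/-- Coordinatewise truncation to the closed ball of radius `ε` around `p`. -/
noncomputable def truncate {V : Type*} (p : V → ℝ) (ε : ℝ) (x : V → ℝ) : V → ℝ :=
  fun i => max (p i - ε) (min (p i + ε) (x i))

section truncate

variable {V : Type*} [Fintype V] {p : V → ℝ} {ε : ℝ}

theorem lipschitzWith_truncate (p : V → ℝ) (ε : ℝ) : LipschitzWith 1 (truncate p ε) := by
  refine LipschitzWith.of_dist_le_mul fun x y => ?_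
  rw [NNReal.coe_one, one_mul, dist_pi_le_iff dist_nonneg]
  intro i
  refine le_trans ?_ (dist_le_pi_dist x y i)
  have h := ((LipschitzWith.id (α := ℝ)).const_min (p i + ε)).const_max (p i - ε)
  simpa [truncate] using h.dist_le_mul (x i) (y i)

theorem truncate_mem_closedBall (hε : 0 ≤ ε) (x : V → ℝ) :
    truncate p ε x ∈ Metric.closedBall p ε := by
  rw [mem_closedBall_iff_norm, pi_norm_le_iff_of_nonneg hε]
  intro i
  rw [Real.norm_eq_abs, Pi.sub_apply, abs_le, truncate]
  constructor
  · linarith [le_max_left (p i - ε) (min (p i + ε) (x i))]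
  · linarith [max_le (show p i - ε ≤ p i + ε by linarith) (min_le_left (p i + ε) (x i))]

theorem truncate_eq_self {x : V → ℝ} (hx : x ∈ Metric.closedBall p ε) : truncate p ε x = x := by
  funext i
  have h := (norm_le_pi_norm (x - p) i).trans (mem_closedBall_iff_norm.1 hx)
  rw [Real.norm_eq_abs, Pi.sub_apply, abs_le] at h
  rw [truncate, min_eq_right (by linarith), max_eq_right (by linarith)]

end truncate

/-- The sup norm is dominated by a weighted Euclidean norm. -/
theorem sq_norm_le_mul_sum {V : Type*} [Fintype V] {m : V → ℝ} (hm : ∀ i, 0 < m i) (w : V → ℝ) :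
    ‖w‖ ^ 2 ≤ (∑ i, (m i)⁻¹) * ∑ i, m i * w i ^ 2 := by
  have hS : 0 ≤ ∑ i, (m i)⁻¹ := Finset.sum_nonneg fun i _ => (inv_pos.2 (hm i)).le
  have hQ : 0 ≤ ∑ i, m i * w i ^ 2 :=
    Finset.sum_nonneg fun i _ => mul_nonneg (hm i).le (sq_nonneg _)
  rw [← Real.le_sqrt (norm_nonneg _) (mul_nonneg hS hQ),
    pi_norm_le_iff_of_nonneg (Real.sqrt_nonneg _)]
  intro i
  refine Real.le_sqrt_of_sq_le ?_
  rw [Real.norm_eq_abs, sq_abs]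
  calc w i ^ 2 = (m i)⁻¹ * (m i * w i ^ 2) := by
        rw [← mul_assoc, inv_mul_cancel₀ (hm i).ne', one_mul]
    _ ≤ _ := by
      refine mul_le_mul
        (Finset.single_le_sum (f := fun i => (m i)⁻¹) (fun j _ => (inv_pos.2 (hm j)).le)
          (Finset.mem_univ i))
        (Finset.single_le_sum (f := fun i => m i * w i ^ 2)
          (fun j _ => mul_nonneg (hm j).le (sq_nonneg _)) (Finset.mem_univ i))
        (mul_nonneg (hm i).le (sq_nonneg _)) hS

/-- Linearized stability: if the linearization of a vector field at an equilibrium is negative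
definite for a weighted inner product, then the equilibrium is exponentially stable. -/
theorem exists_exponentially_stable {V : Type*} [Fintype V] {m : V → ℝ} (hm : ∀ i, 0 < m i)
    {F : (V → ℝ) → V → ℝ} (hF : LocallyLipschitz F) {p : V → ℝ} (hp : F p = 0)
    {A : (V → ℝ) →L[ℝ] V → ℝ} (hA : HasFDerivAt F A p) {c : ℝ} (hc : 0 < c)
    (hneg : ∀ w, ∑ i, m i * w i * A w i ≤ -c * ∑ i, m i * w i ^ 2) :
    ∃ η > 0, ∀ x₀ : V → ℝ, ∑ i, m i * (x₀ i - p i) ^ 2 ≤ η →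
      ∃ α : ℝ → V → ℝ, α 0 = x₀ ∧ ∀ t, 0 ≤ t → HasDerivAt α (F (α t)) t ∧
        ∑ i, m i * (α t i - p i) ^ 2 ≤ η * Real.exp (-(c * t)) := by
  set S := ∑ i, (m i)⁻¹
  set M := ∑ i, m i
  have hS : 0 ≤ S := Finset.sum_nonneg fun i _ => (inv_pos.2 (hm i)).le
  have hM : 0 ≤ M := Finset.sum_nonneg fun i _ => (hm i).le
  -- With this `κ`, the remainder of the linearization costs at most a quarter of the decay rate
  -- `c`.
  set κ := c / (4 * (M * S + 1)) with hκ
  have hκpos : 0 < κ := by positivity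
  have hκS : M * κ * S ≤ c / 4 := by
    rw [hκ, mul_comm M, mul_assoc, div_mul_eq_mul_div,
      div_le_div_iff₀ (by positivity) (by norm_num)]
    nlinarith [mul_nonneg hM hS]
  obtain ⟨ε, hε, hball⟩ := Metric.nhds_basis_closedBall.eventually_iff.1 (hA.isLittleO.bound hκpos)
  have hFε : ∀ x ∈ Metric.closedBall p ε,
      ∑ i, m i * (x i - p i) * F x i ≤ -(3 / 4 * c) * ∑ i, m i * (x i - p i) ^ 2 := by
    intro x hx
    have h1 := hball hx
    rw [hp, sub_zero] at h1
    set w := x - p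
    have h2 : ∑ i, m i * w i * (F x - A w) i ≤ c / 4 * ∑ i, m i * w i ^ 2 := by
      calc ∑ i, m i * w i * (F x - A w) i ≤ ∑ i, m i * (κ * ‖w‖ ^ 2) := by
            refine Finset.sum_le_sum fun i _ => ?_
            rw [mul_assoc]
            refine mul_le_mul_of_nonneg_left ?_ (hm i).le
            calc w i * (F x - A w) i ≤ |w i * (F x - A w) i| := le_abs_self _
              _ = ‖w i‖ * ‖(F x - A w) i‖ := abs_mul _ _
              _ ≤ ‖w‖ * (κ * ‖w‖) := mul_le_mul (norm_le_pi_norm w i)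
                  ((norm_le_pi_norm _ i).trans h1) (norm_nonneg _) (norm_nonneg _)
              _ = κ * ‖w‖ ^ 2 := by ring
        _ = M * κ * ‖w‖ ^ 2 := by rw [← Finset.sum_mul, mul_assoc]
        _ ≤ M * κ * (S * ∑ i, m i * w i ^ 2) :=
            mul_le_mul_of_nonneg_left (sq_norm_le_mul_sum hm w) (mul_nonneg hM hκpos.le)
        _ = (M * κ * S) * ∑ i, m i * w i ^ 2 := by ring
        _ ≤ _ := mul_le_mul_of_nonneg_right hκS
            (Finset.sum_nonneg fun i _ => mul_nonneg (hm i).le (sq_nonneg _))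
    have h3 : ∑ i, m i * w i * F x i =
        ∑ i, m i * w i * (F x - A w) i + ∑ i, m i * w i * A w i := by
      rw [← Finset.sum_add_distrib]
      refine Finset.sum_congr rfl fun i _ => ?_
      rw [Pi.sub_apply]; ring
    have h4 := hneg w
    change ∑ i, m i * w i * F x i ≤ -(3 / 4 * c) * ∑ i, m i * w i ^ 2
    linarith
  obtain ⟨K, hK⟩ := LocallyLipschitzOn.exists_lipschitzOnWith_of_compact
    (isCompact_closedBall p ε) hF.locallyLipschitzOn
  -- The truncated field is bounded and globally Lipschitz, so its solutions are global; it agrees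
  -- with `F` on the ball, which the solution turns out never to leave.
  have hG : LipschitzWith (K * 1) (F ∘ truncate p ε) := by
    rw [← lipschitzOnWith_univ]
    exact hK.comp (lipschitzWith_truncate p ε).lipschitzOnWith
      fun x _ => truncate_mem_closedBall hε.le x
  obtain ⟨L, hL⟩ := (isCompact_closedBall p ε).exists_bound_of_continuousOn
    hF.continuous.continuousOn
  have hL0 : 0 ≤ L := (norm_nonneg _).trans (hL p (Metric.mem_closedBall_self hε.le))
  refine ⟨ε ^ 2 / (S + 1), by positivity, fun x₀ hx₀ => ?_⟩
  -- Chosen so that the sublevel set `∑ mᵢ (xᵢ - pᵢ)² ≤ η` lies in the ball of radius `ε`.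
  set η := ε ^ 2 / (S + 1) with hη
  have hηpos : 0 < η := by positivity
  obtain ⟨α, hα0, hα⟩ := hG.exists_forall_hasDerivAt_of_bounded (L := ⟨L, hL0⟩)
    (fun x => hL _ (truncate_mem_closedBall hε.le x)) x₀
  have hmem : ∀ x : V → ℝ, ∑ i, m i * (x i - p i) ^ 2 ≤ η → x ∈ Metric.closedBall p ε := by
    intro x hx
    rw [mem_closedBall_iff_norm]
    refine (sq_le_sq₀ (norm_nonneg _) hε.le).1 ?_
    calc ‖x - p‖ ^ 2 ≤ S * ∑ i, m i * (x - p) i ^ 2 := sq_norm_le_mul_sum hm _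
      _ ≤ (S + 1) * η := mul_le_mul (by linarith) hx
          (Finset.sum_nonneg fun i _ => mul_nonneg (hm i).le (sq_nonneg _)) (by linarith)
      _ = ε ^ 2 := by rw [hη]; field_simp
  have hderiv : ∀ t, HasDerivAt (fun t => ∑ i, m i * (α t i - p i) ^ 2)
      (2 * ∑ i, m i * (α t i - p i) * (F ∘ truncate p ε) (α t) i) t := by
    intro t
    rw [Finset.mul_sum]
    refine HasDerivAt.fun_sum fun i _ => ?_
    have h := (((hasDerivAt_pi.1 (hα t) i).sub_const (p i)).fun_pow 2).const_mul (m i)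
    refine h.congr_deriv ?_
    push_cast
    ring
  have hB : ∀ t, HasDerivAt (fun t => η * Real.exp (-(c * t)))
      (-c * (η * Real.exp (-(c * t)))) t := by
    intro t
    have h := (((hasDerivAt_id t).const_mul c).neg.exp).const_mul η
    refine h.congr_deriv ?_
    simp only [id_eq, Pi.neg_apply]
    ring
  have hle : ∀ t, 0 ≤ t → ∑ i, m i * (α t i - p i) ^ 2 ≤ η * Real.exp (-(c * t)) := by
    intro t ht
    -- Barrier argument: wherever the Lyapunov function touches `η e^{-ct}`, the point is in the
    -- ball, and the slope is at most `-(3/2) c` times the value, strictly below the slope `-c`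
    -- times the value of the barrier.
    refine image_le_of_deriv_right_lt_deriv_boundary
      (f := fun t => ∑ i, m i * (α t i - p i) ^ 2)
      (B := fun t => η * Real.exp (-(c * t)))
      (fun s _ => (hderiv s).continuousAt.continuousWithinAt)
      (fun s _ => (hderiv s).hasDerivWithinAt) (by simpa [hα0] using hx₀) hB ?_ ⟨ht, le_rfl⟩
    intro s hs hEq
    have hpos : 0 < η * Real.exp (-(c * s)) := by positivity
    have hsη : η * Real.exp (-(c * s)) ≤ η := by
      refine mul_le_of_le_one_right hηpos.le (Real.exp_le_one_iff.2 ?_)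
      have := mul_nonneg hc.le hs.1
      linarith
    have hin := hmem (α s) (hEq.le.trans hsη)
    have h := hFε _ hin
    simp only [Function.comp_apply, truncate_eq_self hin]
    rw [hEq] at h
    nlinarith
  refine ⟨α, hα0, fun t ht => ⟨?_, hle t ht⟩⟩
  have htη : η * Real.exp (-(c * t)) ≤ η := by
    refine mul_le_of_le_one_right hηpos.le (Real.exp_le_one_iff.2 ?_)
    have := mul_nonneg hc.le ht
    linarith
  have h := hα t
  rwa [Function.comp_apply, truncate_eq_self (hmem _ ((hle t ht).trans htη))] at h

/-! ### Angles of a Euclidean triangle as functions of the squared sides -/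

/-- The angle of a Euclidean triangle opposite to the side of squared length `s`, the squared
lengths of the adjacent sides being `p` and `q`. -/
noncomputable def angleOfSq (p q s : ℝ) : ℝ := Real.arccos ((p + q - s) / (2 * √p * √q))

theorem angleOfSq_comm (p q s : ℝ) : angleOfSq p q s = angleOfSq q p s := by
  rw [angleOfSq, angleOfSq, add_comm, mul_right_comm]

section angleOfSq

variable {p q s : ℝ}

/-- The numerator on the right is Heron's expression, sixteen times the squared area. It is
symmetric in the three sides, so one positivity hypothesis serves all three angles. -/
theorem one_sub_cos_sq_eq (hp : 0 < p) (hq : 0 < q) :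
    1 - ((p + q - s) / (2 * √p * √q)) ^ 2 = (4 * p * q - (p + q - s) ^ 2) / (2 * √p * √q) ^ 2 := by
  have hP : 0 < √p := Real.sqrt_pos.2 hp
  have hQ : 0 < √q := Real.sqrt_pos.2 hq
  have h : (2 * √p * √q) ^ 2 = 4 * p * q := by
    rw [mul_pow, mul_pow, Real.sq_sqrt hp.le, Real.sq_sqrt hq.le]; norm_num
  rw [div_pow, h]
  field_simp

theorem sqrt_one_sub_cos_sq_eq (hp : 0 < p) (hq : 0 < q) :
    √(1 - ((p + q - s) / (2 * √p * √q)) ^ 2) =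
      √(4 * p * q - (p + q - s) ^ 2) / (2 * √p * √q) := by
  rw [one_sub_cos_sq_eq hp hq, Real.sqrt_div' _ (by positivity), Real.sqrt_sq (by positivity)]

theorem abs_cos_lt_one (hp : 0 < p) (hq : 0 < q) (hD : 0 < 4 * p * q - (p + q - s) ^ 2) :
    |(p + q - s) / (2 * √p * √q)| < 1 := by
  have hP : 0 < √p := Real.sqrt_pos.2 hp
  have hQ : 0 < √q := Real.sqrt_pos.2 hq
  rw [← sq_lt_one_iff_abs_lt_one, ← sub_pos, one_sub_cos_sq_eq hp hq]
  positivity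

theorem cos_angleOfSq (hp : 0 < p) (hq : 0 < q) (hD : 0 < 4 * p * q - (p + q - s) ^ 2) :
    Real.cos (angleOfSq p q s) = (p + q - s) / (2 * √p * √q) := by
  have h := abs_lt.1 (abs_cos_lt_one hp hq hD)
  exact Real.cos_arccos h.1.le h.2.le

theorem sin_angleOfSq (hp : 0 < p) (hq : 0 < q) :
    Real.sin (angleOfSq p q s) = √(4 * p * q - (p + q - s) ^ 2) / (2 * √p * √q) := by
  rw [angleOfSq, Real.sin_arccos, sqrt_one_sub_cos_sq_eq hp hq]

/-- The angle sum of a Euclidean triangle. -/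
theorem angleOfSq_add_add (hp : 0 < p) (hq : 0 < q) (hs : 0 < s)
    (hD : 0 < 4 * p * q - (p + q - s) ^ 2) :
    angleOfSq p q s + angleOfSq p s q + angleOfSq q s p = Real.pi := by
  have hD1 : 4 * p * s - (p + s - q) ^ 2 = 4 * p * q - (p + q - s) ^ 2 := by ring
  have hD2 : 4 * q * s - (q + s - p) ^ 2 = 4 * p * q - (p + q - s) ^ 2 := by ring
  have hc1 := cos_angleOfSq hp hq hD
  have hc2 := cos_angleOfSq hp hs (hD1 ▸ hD)
  have hc3 := cos_angleOfSq hq hs (hD2 ▸ hD)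
  have hs1 := sin_angleOfSq (s := s) hp hq
  have hs2 := sin_angleOfSq (s := q) hp hs
  rw [hD1] at hs2
  set D := √(4 * p * q - (p + q - s) ^ 2) with hDdef
  have hDpos : 0 < D := Real.sqrt_pos.2 hD
  have hDsq : D ^ 2 = 4 * p * q - (p + q - s) ^ 2 := Real.sq_sqrt hD.le
  have hP : 0 < √p := Real.sqrt_pos.2 hp
  have hQ : 0 < √q := Real.sqrt_pos.2 hq
  have hS : 0 < √s := Real.sqrt_pos.2 hs
  have hP2 := Real.sq_sqrt hp.le
  have hQ2 := Real.sq_sqrt hq.le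
  have hS2 := Real.sq_sqrt hs.le
  set α := angleOfSq p q s
  set β := angleOfSq p s q
  set γ := angleOfSq q s p
  -- The angles `α + β` and `π - γ` have the same cosine; the positive sine of `α + β` then puts
  -- both in `[0, π]`, where the cosine is injective.
  have hcos : Real.cos (α + β) = Real.cos (Real.pi - γ) := by
    rw [Real.cos_pi_sub, Real.cos_add, hc1, hc2, hc3, hs1, hs2]
    have : (p + q - s) * (p + s - q) - D ^ 2 = -(2 * p * (q + s - p)) := by rw [hDsq]; ring
    have h2 : (p + q - s) / (2 * √p * √q) * ((p + s - q) / (2 * √p * √s)) -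
        D / (2 * √p * √q) * (D / (2 * √p * √s)) =
        ((p + q - s) * (p + s - q) - D ^ 2) / (4 * √p ^ 2 * √q * √s) := by
      field_simp; ring
    rw [h2, this, hP2]
    field_simp; ring
  have hsin : 0 < Real.sin (α + β) := by
    rw [Real.sin_add, hc1, hc2, hs1, hs2]
    have h2 : D / (2 * √p * √q) * ((p + s - q) / (2 * √p * √s)) +
        (p + q - s) / (2 * √p * √q) * (D / (2 * √p * √s)) =
        D * (2 * p) / (4 * √p ^ 2 * √q * √s) := by
      field_simp; ring
    rw [h2]
    positivity
  have hα : α ∈ Set.Icc 0 Real.pi := ⟨Real.arccos_nonneg _, Real.arccos_le_pi _⟩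
  have hβ : β ∈ Set.Icc 0 Real.pi := ⟨Real.arccos_nonneg _, Real.arccos_le_pi _⟩
  have hγ : γ ∈ Set.Icc 0 Real.pi := ⟨Real.arccos_nonneg _, Real.arccos_le_pi _⟩
  have hαβ : α + β ≤ Real.pi := by
    by_contra! hlt
    have h := Real.sin_nonneg_of_nonneg_of_le_pi (x := α + β - Real.pi) (by linarith)
      (by linarith [hα.2, hβ.2])
    rw [Real.sin_sub_pi] at h
    linarith
  have := Real.injOn_cos ⟨by linarith [hα.1, hβ.1], hαβ⟩
    (⟨by linarith [hγ.2], by linarith [hγ.1]⟩ : Real.pi - γ ∈ Set.Icc 0 Real.pi) hcos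
  linarith

/-- This is the differentiated law of cosines `2√p√q cos θ = p + q - s`; the denominator equals
`2√p√q sin θ`, four times the area. -/
theorem hasDerivAt_angleOfSq {p q s : ℝ → ℝ} {p' q' s' t : ℝ} (hp : HasDerivAt p p' t)
    (hq : HasDerivAt q q' t) (hs : HasDerivAt s s' t) (hp0 : 0 < p t) (hq0 : 0 < q t)
    (hD : 0 < 4 * p t * q t - (p t + q t - s t) ^ 2) :
    HasDerivAt (fun t => angleOfSq (p t) (q t) (s t))
      ((s' - (p t + s t - q t) / (2 * p t) * p' - (q t + s t - p t) / (2 * q t) * q') /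
        √(4 * p t * q t - (p t + q t - s t) ^ 2)) t := by
  have hlt := abs_lt.1 (abs_cos_lt_one hp0 hq0 hD)
  have hP : 0 < √(p t) := Real.sqrt_pos.2 hp0
  have hQ : 0 < √(q t) := Real.sqrt_pos.2 hq0
  have h1 := ((hp.fun_add hq).fun_sub hs).fun_div
    (((hp.sqrt hp0.ne').const_mul 2).fun_mul (hq.sqrt hq0.ne')) (by positivity)
  have h2 := (Real.hasDerivAt_arccos hlt.1.ne' hlt.2.ne).comp t h1
  refine h2.congr_deriv ?_
  rw [sqrt_one_sub_cos_sq_eq hp0 hq0]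
  set D := √(4 * p t * q t - (p t + q t - s t) ^ 2)
  have hDpos : 0 < D := Real.sqrt_pos.2 hD
  have hP2 := Real.sq_sqrt hp0.le
  have hQ2 := Real.sq_sqrt hq0.le
  generalize √(p t) = P at *
  generalize √(q t) = Q at *
  rw [← hP2, ← hQ2]
  field_simp
  ring

theorem contDiff_angleOfSq {E : Type*} [NormedAddCommGroup E] [NormedSpace ℝ E] {n : ℕ∞}
    {p q s : E → ℝ} (hp : ContDiff ℝ n p) (hq : ContDiff ℝ n q) (hs : ContDiff ℝ n s)
    (hp0 : ∀ u, 0 < p u) (hq0 : ∀ u, 0 < q u)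
    (hD : ∀ u, 0 < 4 * p u * q u - (p u + q u - s u) ^ 2) :
    ContDiff ℝ n fun u => angleOfSq (p u) (q u) (s u) := by
  rw [contDiff_iff_contDiffAt]
  intro u
  have hlt := abs_lt.1 (abs_cos_lt_one (hp0 u) (hq0 u) (hD u))
  have hP : 0 < √(p u) := Real.sqrt_pos.2 (hp0 u)
  have hQ : 0 < √(q u) := Real.sqrt_pos.2 (hq0 u)
  exact (Real.contDiffAt_arccos hlt.1.ne' hlt.2.ne).comp u
    (((hp.add hq).sub hs).contDiffAt.div
      ((contDiff_const.mul (hp.sqrt fun u => (hp0 u).ne')).mul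
        (hq.sqrt fun u => (hq0 u).ne')).contDiffAt (by positivity))

end angleOfSq

/-! ### Triangles spanned by three circles -/

/-- The squared distance of the centres of two circles of radii `x`, `y` that meet at the angle
with cosine `c`. -/
def circleDistSq (x y c : ℝ) : ℝ := x ^ 2 + y ^ 2 + 2 * x * y * c

/-- Sixteen times the squared area of the triangle formed by the centres of three circles of radii
`x`, `y`, `z`, where `c`, `b`, `a` are the cosines of the intersection angles of the pairs `xy`,
`xz`, `yz`. -/
def circleHeron (x y z c b a : ℝ) : ℝ :=
  4 * (x ^ 2 * y ^ 2 * (1 - c ^ 2) + x ^ 2 * z ^ 2 * (1 - b ^ 2) + y ^ 2 * z ^ 2 * (1 - a ^ 2) +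
    2 * x * y * z * (x * (a + b * c) + y * (b + a * c) + z * (c + a * b)))

/-- The conductance of the edge `xy` in the triangle formed by the centres of three circles. -/
noncomputable def circleConductance (x y z c b a : ℝ) : ℝ :=
  x * y * (x * y * (1 - c ^ 2) + x * z * (a + b * c) + y * z * (b + a * c)) /
    (√(circleHeron x y z c b a) * circleDistSq x y c)

section circle

variable {x y z c b a : ℝ}

theorem circleDistSq_comm (x y c : ℝ) : circleDistSq x y c = circleDistSq y x c := by
  unfold circleDistSq; ring

theorem circleDistSq_pos (hx : 0 < x) (hy : 0 < y) (hc : 0 ≤ c) : 0 < circleDistSq x y c := by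
  unfold circleDistSq; positivity

theorem circleHeron_eq (x y z c b a : ℝ) :
    4 * circleDistSq x y c * circleDistSq x z b -
      (circleDistSq x y c + circleDistSq x z b - circleDistSq y z a) ^ 2 =
    circleHeron x y z c b a := by
  unfold circleDistSq circleHeron; ring

theorem circleHeron_swap_left (x y z c b a : ℝ) :
    circleHeron y x z c a b = circleHeron x y z c b a := by
  unfold circleHeron; ring

theorem circleHeron_swap_right (x y z c b a : ℝ) :
    circleHeron x z y b c a = circleHeron x y z c b a := by
  unfold circleHeron; ring

/-- The symmetry `∂θᵢ/∂uⱼ = ∂θⱼ/∂uᵢ`, which makes the Jacobian of the curvature symmetric. -/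
theorem circleConductance_swap (x y z c b a : ℝ) :
    circleConductance y x z c a b = circleConductance x y z c b a := by
  unfold circleConductance
  rw [circleHeron_swap_left, circleDistSq_comm y x]
  congr 1
  ring

/-- Weights in `[0, π/2]` make every summand nonnegative, so any radii give a nondegenerate
triangle. Strictness comes from `x²y²(1 - c²)` if `c = 0` and from `z (c + ab)` if `c > 0`. -/
theorem circleHeron_pos (hx : 0 < x) (hy : 0 < y) (hz : 0 < z) (hc : c ∈ Set.Icc (0 : ℝ) 1)
    (hb : b ∈ Set.Icc (0 : ℝ) 1) (ha : a ∈ Set.Icc (0 : ℝ) 1) : 0 < circleHeron x y z c b a := by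
  obtain ⟨hc0, hc1⟩ := hc
  obtain ⟨hb0, hb1⟩ := hb
  obtain ⟨ha0, ha1⟩ := ha
  have h1 : 0 ≤ 1 - c ^ 2 := by nlinarith
  have h2 : 0 ≤ 1 - b ^ 2 := by nlinarith
  have h3 : 0 ≤ 1 - a ^ 2 := by nlinarith
  unfold circleHeron
  rcases hc0.eq_or_lt with rfl | hc0
  · norm_num
    positivity
  · positivity

theorem circleConductance_nonneg (hx : 0 < x) (hy : 0 < y) (hz : 0 < z)
    (hc : c ∈ Set.Icc (0 : ℝ) 1) (hb : b ∈ Set.Icc (0 : ℝ) 1) (ha : a ∈ Set.Icc (0 : ℝ) 1) :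
    0 ≤ circleConductance x y z c b a := by
  have h1 : 0 ≤ 1 - c ^ 2 := by nlinarith [hc.1, hc.2]
  have hd := circleDistSq_pos hx hy hc.1
  have := hb.1
  have := ha.1
  have := hc.1
  unfold circleConductance
  positivity

/-- A vanishing conductance forces the third circle to be orthogonal to the other two, which are
tangent. -/
theorem circleConductance_pos (hx : 0 < x) (hy : 0 < y) (hz : 0 < z)
    (hc : c ∈ Set.Icc (0 : ℝ) 1) (hb : b ∈ Set.Icc (0 : ℝ) 1) (ha : a ∈ Set.Icc (0 : ℝ) 1)
    (h : c < 1 ∨ 0 < a ∨ 0 < b) : 0 < circleConductance x y z c b a := by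
  have h1 : 0 ≤ 1 - c ^ 2 := by nlinarith [hc.1, hc.2]
  have hd := circleDistSq_pos hx hy hc.1
  have hH := Real.sqrt_pos.2 (circleHeron_pos hx hy hz hc hb ha)
  have hb0 := hb.1
  have ha0 := ha.1
  have hc0 := hc.1
  unfold circleConductance
  refine div_pos (mul_pos (mul_pos hx hy) ?_) (mul_pos hH hd)
  rcases h with h | h | h
  · have : 0 < 1 - c ^ 2 := by nlinarith [hc.1, hc.2]
    positivity
  · positivity
  · positivity

theorem hasDerivAt_circleDistSq {x y : ℝ → ℝ} {α β t : ℝ} (hx : HasDerivAt x (x t * α / 2) t)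
    (hy : HasDerivAt y (y t * β / 2) t) (c : ℝ) :
    HasDerivAt (fun t => circleDistSq (x t) (y t) c)
      (x t ^ 2 * α + y t ^ 2 * β + x t * y t * c * (α + β)) t := by
  have h := ((hx.fun_pow 2).fun_add (hy.fun_pow 2)).fun_add
    (((hx.const_mul 2).fun_mul hy).mul_const c)
  refine h.congr_deriv ?_
  push_cast
  ring

/-- The derivative of the angle at the centre of the first circle, under a variation with
logarithmic derivatives `α`, `β`, `γ` of the squared radii. -/
theorem hasDerivAt_circleAngle {x y z : ℝ → ℝ} {α β γ t : ℝ} (hx : HasDerivAt x (x t * α / 2) t)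
    (hy : HasDerivAt y (y t * β / 2) t) (hz : HasDerivAt z (z t * γ / 2) t)
    (hx0 : 0 < x t) (hy0 : 0 < y t) (hz0 : 0 < z t) (hc : c ∈ Set.Icc (0 : ℝ) 1)
    (hb : b ∈ Set.Icc (0 : ℝ) 1) (ha : a ∈ Set.Icc (0 : ℝ) 1) :
    HasDerivAt (fun t => angleOfSq (circleDistSq (x t) (y t) c) (circleDistSq (x t) (z t) b)
        (circleDistSq (y t) (z t) a))
      (circleConductance (x t) (y t) (z t) c b a * (β - α) +
        circleConductance (x t) (z t) (y t) b c a * (γ - α)) t := by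
  have hp0 := circleDistSq_pos hx0 hy0 hc.1
  have hq0 := circleDistSq_pos hx0 hz0 hb.1
  have hH := circleHeron_pos hx0 hy0 hz0 hc hb ha
  have h := hasDerivAt_angleOfSq (hasDerivAt_circleDistSq hx hy c) (hasDerivAt_circleDistSq hx hz b)
    (hasDerivAt_circleDistSq hy hz a) hp0 hq0 (by rwa [circleHeron_eq])
  rw [circleHeron_eq] at h
  -- Angles are invariant under a common scaling, so only the differences `β - α` and `γ - α`
  -- survive; after clearing denominators this is a polynomial identity.
  refine h.congr_deriv ?_
  unfold circleConductance
  rw [circleHeron_swap_right]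
  have hD := Real.sqrt_pos.2 hH
  set D := √(circleHeron (x t) (y t) (z t) c b a)
  generalize x t = X at *
  generalize y t = Y at *
  generalize z t = Z at *
  field_simp
  unfold circleDistSq
  ring

end circle

/-! ### Counting simplices and the Gauss-Bonnet formula -/

theorem mem_complex_of_subset {V : Type*} {K : AbstractSimplicialComplex V} {s t : Finset V}
    (hs : s ∈ K) (hts : t ⊆ s) (ht : t.Nonempty) : t ∈ K :=
  (K.isRelLowerSet_faces hs).2 hts ht

section IsTriangle

variable {V : Type*} [DecidableEq V] {K : AbstractSimplicialComplex V} {i j k : V}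

theorem IsTriangle.swap_left (h : IsTriangle K i j k) : IsTriangle K j i k :=
  ⟨h.1.symm, h.2.2.1, h.2.1, by rw [Finset.insert_comm]; exact h.2.2.2⟩

theorem IsTriangle.swap_right (h : IsTriangle K i j k) : IsTriangle K i k j :=
  ⟨h.2.2.1, h.2.1.symm, h.1, by rw [Finset.pair_comm]; exact h.2.2.2⟩

theorem isTriangle_swap_left : IsTriangle K i j k ↔ IsTriangle K j i k :=
  ⟨.swap_left, .swap_left⟩

theorem isTriangle_swap_right : IsTriangle K i j k ↔ IsTriangle K i k j :=
  ⟨.swap_right, .swap_right⟩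

theorem IsTriangle.adj (h : IsTriangle K i j k) : (skeletonGraph K).Adj i j :=
  ⟨h.1, mem_complex_of_subset h.2.2.2 (by intro; simp; tauto) (by simp)⟩

end IsTriangle

/-- Converts sums over ordered triples, the form in which angle sums are written, into sums over
triangles. -/
theorem card_filter_triple_eq {V : Type*} [Fintype V] [DecidableEq V] {a b c : V} (hab : a ≠ b)
    (hbc : b ≠ c) (hac : a ≠ c) :
    (Finset.univ.filter fun p : V × V × V => (p.1 ≠ p.2.1 ∧ p.2.1 ≠ p.2.2 ∧ p.1 ≠ p.2.2) ∧
      ({p.1, p.2.1, p.2.2} : Finset V) = {a, b, c}).card = 6 := by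
  have : (Finset.univ.filter fun p : V × V × V => (p.1 ≠ p.2.1 ∧ p.2.1 ≠ p.2.2 ∧ p.1 ≠ p.2.2) ∧
      ({p.1, p.2.1, p.2.2} : Finset V) = {a, b, c}) =
      {(a, b, c), (a, c, b), (b, a, c), (b, c, a), (c, a, b), (c, b, a)} := by
    ext ⟨i, j, k⟩
    simp only [Finset.mem_filter, Finset.mem_univ, true_and, Finset.mem_insert,
      Finset.mem_singleton, Prod.mk.injEq]
    constructor
    · rintro ⟨⟨h1, h2, h3⟩, h⟩
      have hi : i ∈ ({a, b, c} : Finset V) := h ▸ by simp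
      have hj : j ∈ ({a, b, c} : Finset V) := h ▸ by simp
      have hk : k ∈ ({a, b, c} : Finset V) := h ▸ by simp
      simp only [Finset.mem_insert, Finset.mem_singleton] at hi hj hk
      grind
    · rintro (⟨rfl, rfl, rfl⟩ | ⟨rfl, rfl, rfl⟩ | ⟨rfl, rfl, rfl⟩ | ⟨rfl, rfl, rfl⟩ |
        ⟨rfl, rfl, rfl⟩ | ⟨rfl, rfl, rfl⟩) <;> grind
  rw [this]
  repeat rw [Finset.card_insert_of_notMem (by simp [*, hab.symm, hbc.symm, hac.symm])]
  simp

namespace WeightedTriangulatedSurface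

variable {V : Type*} [Fintype V] [DecidableEq V] (T : WeightedTriangulatedSurface V)

/-- The edges of the triangulation. -/
noncomputable def edges : Finset (Finset V) := by
  classical exact Finset.univ.filter fun e => e ∈ T.complex ∧ e.card = 2

/-- The triangles of the triangulation. -/
noncomputable def triangles : Finset (Finset V) := by
  classical exact Finset.univ.filter fun t => t ∈ T.complex ∧ t.card = 3

theorem mem_edges {e : Finset V} : e ∈ T.edges ↔ e ∈ T.complex ∧ e.card = 2 := by
  simp [edges]

theorem mem_triangles {t : Finset V} : t ∈ T.triangles ↔ t ∈ T.complex ∧ t.card = 3 := by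
  simp [triangles]

theorem eulerChar_eq :
    T.eulerChar = (Fintype.card V : ℤ) - T.edges.card + T.triangles.card := by
  rw [eulerChar, ← Set.ncard_coe_finset T.edges, ← Set.ncard_coe_finset T.triangles]
  congr 4 <;> ext <;> simp [mem_edges, mem_triangles]

/-- Double counting of incident pairs: an edge lies in two triangles, a triangle has three edges. -/
theorem card_edges_mul_two : T.edges.card * 2 = T.triangles.card * 3 := by
  classical
  refine Finset.card_mul_eq_card_mul (fun e t => e ⊆ t) (fun e he => ?_) fun t ht => ?_
  · rw [← T.edge_in_two_triangles e (T.mem_edges.1 he).1 (T.mem_edges.1 he).2,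
      ← Set.ncard_coe_finset]
    congr 1
    ext t
    simp [Finset.bipartiteAbove, mem_triangles, and_assoc]
  · obtain ⟨ht, hc⟩ := T.mem_triangles.1 ht
    have : Finset.bipartiteBelow (fun e t => e ⊆ t) T.edges t = t.powersetCard 2 := by
      ext e
      simp only [Finset.bipartiteBelow, Finset.mem_filter, mem_edges, Finset.mem_powersetCard]
      refine ⟨fun h => ⟨h.2, h.1.2⟩, fun h => ⟨⟨mem_complex_of_subset ht h.1 ?_, h.2⟩, h.1⟩⟩
      rw [← Finset.card_pos, h.2]
      norm_num
    rw [this, Finset.card_powersetCard, hc]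
    rfl

open Classical in
theorem card_isTriangle : (Finset.univ.filter fun p : V × V × V =>
    IsTriangle T.complex p.1 p.2.1 p.2.2).card = T.triangles.card * 6 := by
  rw [Finset.card_eq_sum_card_fiberwise (t := T.triangles)
    (f := fun p : V × V × V => ({p.1, p.2.1, p.2.2} : Finset V))]
  · refine Finset.sum_const_nat fun t ht => ?_
    obtain ⟨ht, hc⟩ := T.mem_triangles.1 ht
    obtain ⟨a, b, c, hab, hac, hbc, rfl⟩ := Finset.card_eq_three.1 hc
    rw [← card_filter_triple_eq hab hbc hac, Finset.filter_filter]
    congr 1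
    ext p
    simp only [Finset.mem_filter, Finset.mem_univ, true_and]
    constructor
    · rintro ⟨⟨h1, h2, h3, -⟩, h⟩
      exact ⟨⟨h1, h2, h3⟩, h⟩
    · rintro ⟨⟨h1, h2, h3⟩, h⟩
      exact ⟨⟨h1, h2, h3, h ▸ ht⟩, h⟩
  · intro p hp
    obtain ⟨h1, h2, h3, h⟩ := (Finset.mem_filter.1 hp).2
    exact T.mem_triangles.2 ⟨h, Finset.card_eq_three.2 ⟨_, _, _, h1, h3, h2, rfl⟩⟩

/-- The cosine of the weight of an edge. -/
noncomputable def cosWeight (i j : V) : ℝ := Real.cos (T.weight s(i, j))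

theorem cosWeight_comm (i j : V) : T.cosWeight i j = T.cosWeight j i := by
  rw [cosWeight, Sym2.eq_swap, cosWeight]

variable {T} in
theorem cosWeight_mem {i j : V} (h : (skeletonGraph T.complex).Adj i j) :
    T.cosWeight i j ∈ Set.Icc (0 : ℝ) 1 := by
  have hw := T.weight_mem i j h
  exact ⟨Real.cos_nonneg_of_mem_Icc ⟨by linarith [hw.1, Real.pi_pos], hw.2⟩, Real.cos_le_one _⟩

theorem edgeLength_eq (r : V → ℝ) (i j : V) :
    T.edgeLength r i j = √(circleDistSq (r i) (r j) (T.cosWeight i j)) := rfl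

section positive

variable {T} {r : V → ℝ} {i j k : V}

theorem innerAngle_eq (hr : ∀ i, 0 < r i) (h : IsTriangle T.complex i j k) :
    T.innerAngle r i j k = angleOfSq (circleDistSq (r i) (r j) (T.cosWeight i j))
      (circleDistSq (r i) (r k) (T.cosWeight i k))
      (circleDistSq (r j) (r k) (T.cosWeight j k)) := by
  rw [innerAngle, angleOfSq, edgeLength_eq, edgeLength_eq, edgeLength_eq,
    Real.sq_sqrt (circleDistSq_pos (hr i) (hr j) (cosWeight_mem h.adj).1).le,
    Real.sq_sqrt (circleDistSq_pos (hr i) (hr k) (cosWeight_mem h.swap_right.adj).1).le,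
    Real.sq_sqrt
      (circleDistSq_pos (hr j) (hr k) (cosWeight_mem h.swap_left.swap_right.adj).1).le]

theorem innerAngle_add_add (hr : ∀ i, 0 < r i) (h : IsTriangle T.complex i j k) :
    T.innerAngle r i j k + T.innerAngle r j k i + T.innerAngle r k i j = Real.pi := by
  have hij := cosWeight_mem h.adj
  have hik := cosWeight_mem h.swap_right.adj
  have hjk := cosWeight_mem h.swap_left.swap_right.adj
  rw [innerAngle_eq hr h, innerAngle_eq hr h.swap_left.swap_right,
    innerAngle_eq hr h.swap_right.swap_left]
  have key := angleOfSq_add_add (circleDistSq_pos (hr i) (hr j) hij.1)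
    (circleDistSq_pos (hr i) (hr k) hik.1) (circleDistSq_pos (hr j) (hr k) hjk.1)
    (by rw [circleHeron_eq]; exact circleHeron_pos (hr i) (hr j) (hr k) hij hik hjk)
  rw [T.cosWeight_comm j i, T.cosWeight_comm k i, T.cosWeight_comm k j,
    circleDistSq_comm (r j) (r i), circleDistSq_comm (r k) (r i), circleDistSq_comm (r k) (r j)]
  rw [angleOfSq_comm (circleDistSq (r j) (r k) _)]
  linarith

end positive

/-- The combinatorial Gauss-Bonnet formula. -/
theorem sum_angleDeficit {r : V → ℝ} (hr : ∀ i, 0 < r i) :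
    ∑ i, T.angleDeficit r i = 2 * Real.pi * T.eulerChar := by
  classical
  set f : V → V → V → ℝ := fun i j k =>
    if IsTriangle T.complex i j k then T.innerAngle r i j k else 0
  have h1 : ∀ i j k, f i j k + f j k i + f k i j =
      if IsTriangle T.complex i j k then Real.pi else 0 := by
    intro i j k
    by_cases h : IsTriangle T.complex i j k
    · simp only [f]
      rw [if_pos h, if_pos h.swap_left.swap_right, if_pos h.swap_right.swap_left, if_pos h,
        innerAngle_add_add hr h]
    · have h2 : ¬ IsTriangle T.complex j k i := fun h' => h h'.swap_right.swap_left
      have h3 : ¬ IsTriangle T.complex k i j := fun h' => h h'.swap_left.swap_right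
      simp [f, h, h2, h3]
  -- Cyclic relabelling shows that the three angles of a triangle contribute equally to the total,
  -- which is therefore one third of the sum of `π` over ordered triples.
  have hrot : ∀ g : V → V → V → ℝ, ∑ i, ∑ j, ∑ k, g j k i = ∑ i, ∑ j, ∑ k, g i j k := by
    intro g
    rw [Finset.sum_comm]
    exact Finset.sum_congr rfl fun i _ => Finset.sum_comm
  have h2 := hrot f
  have h3 := (hrot fun i j k => f j k i).trans h2
  have h4 : ∑ i : V, ∑ j : V, ∑ k : V, (if IsTriangle T.complex i j k then Real.pi else 0) =
      T.triangles.card * 6 * Real.pi := by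
    have h : ∑ p : V × V × V, (if IsTriangle T.complex p.1 p.2.1 p.2.2 then Real.pi else 0) =
        T.triangles.card * 6 * Real.pi := by
      rw [← Finset.sum_filter, Finset.sum_const, T.card_isTriangle, nsmul_eq_mul]
      push_cast
      ring
    rw [← h, Fintype.sum_prod_type]
    exact Finset.sum_congr rfl fun i _ => (Fintype.sum_prod_type
      fun p : V × V => if IsTriangle T.complex i p.1 p.2 then Real.pi else 0).symm
  have h5 : ∑ i, ∑ j, ∑ k, f i j k = T.triangles.card * 2 * Real.pi := by
    have : ∑ i, ∑ j, ∑ k, (f i j k + f j k i + f k i j) = T.triangles.card * 6 * Real.pi := by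
      simp only [h1, h4]
    simp only [Finset.sum_add_distrib] at this
    linarith
  have hE : (T.edges.card : ℝ) * 2 = T.triangles.card * 3 := by exact_mod_cast T.card_edges_mul_two
  have h6 : ∑ i, T.angleDeficit r i =
      Fintype.card V * (2 * Real.pi) - (∑ i, ∑ j, ∑ k, f i j k) / 2 := by
    simp only [angleDeficit, Finset.sum_sub_distrib, Finset.sum_div]
    simp [f]
  rw [h6, h5, T.eulerChar_eq]
  push_cast
  -- The total is `2π|V| - π|F|`, and `2|E| = 3|F|` turns this into `2πχ`.
  linear_combination Real.pi * hE

end WeightedTriangulatedSurface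

/-! ### The Jacobian of the angle deficits as a weighted graph Laplacian -/

namespace WeightedTriangulatedSurface

section expHalf

variable {V : Type*}

/-- The radii with logarithmic coordinates `u = ln r²`. -/
noncomputable def expHalf (u : V → ℝ) : V → ℝ := fun v => Real.exp (u v / 2)

theorem expHalf_pos (u : V → ℝ) (i : V) : 0 < expHalf u i := Real.exp_pos _

theorem expHalf_sq (u : V → ℝ) (i : V) : expHalf u i ^ 2 = Real.exp (u i) := by
  rw [expHalf, ← Real.exp_nat_mul]
  congr 1
  push_cast
  ring

theorem expHalf_log_sq {r : V → ℝ} (hr : ∀ i, 0 < r i) :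
    expHalf (fun v => Real.log (r v ^ 2)) = r := by
  funext i
  rw [expHalf, Real.log_pow]
  push_cast
  rw [mul_div_cancel_left₀ _ (by norm_num), Real.exp_log (hr i)]

/-- The term `u + 0 • v` is left unreduced to match the shape `x t * α / 2` required by
`hasDerivAt_circleAngle`. -/
theorem hasDerivAt_expHalf (u v : V → ℝ) (i : V) :
    HasDerivAt (fun t : ℝ => expHalf (u + t • v) i) (expHalf (u + (0 : ℝ) • v) i * v i / 2) 0 := by
  have h := ((((hasDerivAt_id (0 : ℝ)).mul_const (v i)).const_add (u i)).div_const 2).exp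
  refine h.congr_deriv ?_
  simp [expHalf]
  ring

theorem normSq_expHalf [Fintype V] (u : V → ℝ) : normSq (expHalf u) = ∑ i, Real.exp (u i) := by
  simp only [normSq, expHalf_sq]

theorem contDiff_sum_exp [Fintype V] : ContDiff ℝ 1 fun u : V → ℝ => ∑ j, Real.exp (u j) :=
  ContDiff.sum fun j _ => (contDiff_apply ℝ ℝ j).exp

end expHalf

variable {V : Type*} [Fintype V] [DecidableEq V] (T : WeightedTriangulatedSurface V)

/-- The derivative `∂θ/∂u` of the angle at `i` of the triangle `ijk` in the direction of `j`. -/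
noncomputable def conductance (r : V → ℝ) (i j k : V) : ℝ :=
  circleConductance (r i) (r j) (r k) (T.cosWeight i j) (T.cosWeight i k) (T.cosWeight j k)

open Classical in
/-- The sum of the conductances of an edge over the adjacent triangles. -/
noncomputable def edgeConductance (r : V → ℝ) (i j : V) : ℝ :=
  ∑ k, if IsTriangle T.complex i j k then T.conductance r i j k else 0

theorem edgeConductance_comm (r : V → ℝ) (i j : V) :
    T.edgeConductance r i j = T.edgeConductance r j i := by
  classical
  refine Finset.sum_congr rfl fun k _ => ?_
  rw [isTriangle_swap_left]
  refine if_congr Iff.rfl ?_ rfl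
  rw [conductance, conductance, ← circleConductance_swap, T.cosWeight_comm i j]

variable {T} in
theorem edgeConductance_eq_zero {r : V → ℝ} {i j : V} (h : ¬ (skeletonGraph T.complex).Adj i j) :
    T.edgeConductance r i j = 0 := by
  classical
  exact Finset.sum_eq_zero fun k _ => if_neg fun h' => h h'.adj

variable {T} in
theorem conductance_nonneg {r : V → ℝ} (hr : ∀ i, 0 < r i) {i j k : V}
    (h : IsTriangle T.complex i j k) : 0 ≤ T.conductance r i j k :=
  circleConductance_nonneg (hr i) (hr j) (hr k) (cosWeight_mem h.adj)
    (cosWeight_mem h.swap_right.adj) (cosWeight_mem h.swap_left.swap_right.adj)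

variable {T} in
theorem conductance_le_edgeConductance {r : V → ℝ} (hr : ∀ i, 0 < r i) {i j k : V}
    (h : IsTriangle T.complex i j k) : T.conductance r i j k ≤ T.edgeConductance r i j := by
  classical
  have := Finset.single_le_sum
    (f := fun k => if IsTriangle T.complex i j k then T.conductance r i j k else 0)
    (fun k _ => by split_ifs with h; exacts [conductance_nonneg hr h, le_rfl])
    (Finset.mem_univ k)
  rwa [if_pos h] at this

theorem edgeConductance_nonneg {r : V → ℝ} (hr : ∀ i, 0 < r i) (i j : V) :
    0 ≤ T.edgeConductance r i j := by
  classical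
  refine Finset.sum_nonneg fun k _ => ?_
  split_ifs with h
  exacts [conductance_nonneg hr h, le_rfl]

variable {T} in
theorem hasDerivAt_innerAngle (u v : V → ℝ) {i j k : V} (h : IsTriangle T.complex i j k) :
    HasDerivAt (fun t : ℝ => T.innerAngle (expHalf (u + t • v)) i j k)
      (T.conductance (expHalf u) i j k * (v j - v i) +
        T.conductance (expHalf u) i k j * (v k - v i)) 0 := by
  have key := hasDerivAt_circleAngle (hasDerivAt_expHalf u v i) (hasDerivAt_expHalf u v j)
    (hasDerivAt_expHalf u v k) (expHalf_pos _ _) (expHalf_pos _ _) (expHalf_pos _ _)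
    (cosWeight_mem h.adj) (cosWeight_mem h.swap_right.adj)
    (cosWeight_mem h.swap_left.swap_right.adj)
  simp only [← innerAngle_eq (expHalf_pos _) h, zero_smul, add_zero] at key
  rw [conductance, conductance, T.cosWeight_comm k j]
  exact key

variable {T} in
theorem contDiff_innerAngle {i j k : V} (h : IsTriangle T.complex i j k) :
    ContDiff ℝ 1 fun u : V → ℝ => T.innerAngle (expHalf u) i j k := by
  simp only [innerAngle_eq (expHalf_pos _) h]
  have hij := cosWeight_mem h.adj
  have hik := cosWeight_mem h.swap_right.adj
  have hjk := cosWeight_mem h.swap_left.swap_right.adj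
  have hexp : ∀ i : V, ContDiff ℝ 1 fun u : V → ℝ => expHalf u i := fun i =>
    ((contDiff_apply ℝ ℝ i).div_const 2).exp
  have hdist : ∀ (i j : V) (c : ℝ), ContDiff ℝ 1 fun u : V → ℝ =>
      circleDistSq (expHalf u i) (expHalf u j) c := fun i j c =>
    (((hexp i).pow 2).add ((hexp j).pow 2)).add
      (((contDiff_const.mul (hexp i)).mul (hexp j)).mul contDiff_const)
  refine contDiff_angleOfSq (n := 1) (hdist _ _ _) (hdist _ _ _) (hdist _ _ _)
    (fun u => circleDistSq_pos (expHalf_pos _ _) (expHalf_pos _ _) hij.1)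
    (fun u => circleDistSq_pos (expHalf_pos _ _) (expHalf_pos _ _) hik.1) fun u => ?_
  rw [circleHeron_eq]
  exact circleHeron_pos (expHalf_pos _ _) (expHalf_pos _ _) (expHalf_pos _ _) hij hik hjk

/-- The angle deficit in logarithmic coordinates. -/
noncomputable def logDeficit (i : V) (u : V → ℝ) : ℝ := T.angleDeficit (expHalf u) i

theorem contDiff_logDeficit (i : V) : ContDiff ℝ 1 (T.logDeficit i) := by
  classical
  refine contDiff_const.sub (ContDiff.div_const (ContDiff.sum fun j _ => ContDiff.sum
    fun k _ => ?_) 2)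
  by_cases h : IsTriangle T.complex i j k
  · simpa only [if_pos h] using contDiff_innerAngle h
  · simpa only [if_neg h] using contDiff_const

theorem fderiv_logDeficit (i : V) (u v : V → ℝ) :
    fderiv ℝ (T.logDeficit i) u v = -∑ j, T.edgeConductance (expHalf u) i j * (v j - v i) := by
  classical
  have hd : DifferentiableAt ℝ (T.logDeficit i) u :=
    (T.contDiff_logDeficit i).differentiable one_ne_zero u
  have h1 : HasDerivAt (fun t : ℝ => T.logDeficit i (u + t • v))
      (fderiv ℝ (T.logDeficit i) u v) 0 := by
    have := hd.hasFDerivAt.hasLineDerivAt v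
    exact this
  have h2 : HasDerivAt (fun t : ℝ => T.logDeficit i (u + t • v))
      (0 - (∑ j, ∑ k, if IsTriangle T.complex i j k then
        T.conductance (expHalf u) i j k * (v j - v i) +
        T.conductance (expHalf u) i k j * (v k - v i) else 0) / 2) 0 := by
    refine HasDerivAt.fun_sub (hasDerivAt_const _ _) (HasDerivAt.div_const
      (HasDerivAt.fun_sum fun j _ => HasDerivAt.fun_sum fun k _ => ?_) 2)
    by_cases h : IsTriangle T.complex i j k
    · simpa only [if_pos h] using hasDerivAt_innerAngle u v h
    · simpa only [if_neg h] using hasDerivAt_const _ _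
  rw [h1.unique h2, zero_sub, neg_inj]
  set g : V → V → ℝ := fun j k => if IsTriangle T.complex i j k then
        T.conductance (expHalf u) i j k * (v j - v i) else 0
  -- Each triangle occurs as `(j, k)` and as `(k, j)`; splitting the summand into two mirror images
  -- cancels the division by two.
  have h3 : ∀ j k, (if IsTriangle T.complex i j k then
        T.conductance (expHalf u) i j k * (v j - v i) +
        T.conductance (expHalf u) i k j * (v k - v i) else 0) = g j k + g k j := by
    intro j k
    simp only [g]
    rw [isTriangle_swap_right (j := k)]
    split_ifs <;> simp
  simp only [h3, Finset.sum_add_distrib]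
  rw [Finset.sum_comm (f := fun j k => g k j), add_self_div_two]
  refine Finset.sum_congr rfl fun j _ => ?_
  rw [edgeConductance, Finset.sum_mul]
  refine Finset.sum_congr rfl fun k _ => ?_
  simp only [g, ite_mul, zero_mul]

theorem partialDeficit_eq {r : V → ℝ} (hr : ∀ i, 0 < r i) {i j : V} (hij : i ≠ j) :
    T.partialDeficit r i j = -T.edgeConductance r i j := by
  have h := T.fderiv_logDeficit i (fun v => Real.log (r v ^ 2)) (Pi.single j 1)
  rw [expHalf_log_sq hr] at h
  change fderiv ℝ (T.logDeficit i) _ _ = _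
  rw [h, neg_inj, Finset.sum_eq_single j]
  · simp [hij]
  · intro k _ hk
    simp [hij, hk]
  · simp

/-- The differential of the angle deficits with respect to the logarithmic coordinates. -/
noncomputable def deficitDeriv (r : V → ℝ) (v : V → ℝ) (i : V) : ℝ :=
  -∑ j, T.edgeConductance r i j * (v j - v i)

/-- Conductances vanish off the edges, so the sum over neighbours may run over all vertices. This
carries the eigenvalue hypothesis over to `deficitDeriv`. -/
theorem neg_laplacian_apply {r : V → ℝ} (hr : ∀ i, 0 < r i) (f : V → ℝ) (i : V) :
    (-T.laplacian r) f i = T.deficitDeriv r f i / r i ^ 2 := by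
  classical
  rw [LinearMap.neg_apply, Pi.neg_apply, deficitDeriv, neg_div, neg_inj, laplacian]
  simp only [LinearMap.coe_mk, AddHom.coe_mk]
  rw [one_div_mul_eq_div]
  congr 1
  refine Finset.sum_congr rfl fun j _ => ?_
  split_ifs with h
  · rw [T.partialDeficit_eq hr h.1, neg_neg]
  · rw [edgeConductance_eq_zero h, zero_mul]

/-- Symmetrization in `i` and `j` gives the Dirichlet form, from which self-adjointness and
nonnegativity can be read off. -/
theorem sum_mul_deficitDeriv (r f g : V → ℝ) :
    ∑ i, g i * T.deficitDeriv r f i =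
      (∑ i, ∑ j, T.edgeConductance r i j * (f i - f j) * (g i - g j)) / 2 := by
  have h1 : ∀ i, g i * T.deficitDeriv r f i =
      ∑ j, T.edgeConductance r i j * (f i - f j) * g i := by
    intro i
    rw [deficitDeriv, mul_neg, ← neg_mul, Finset.mul_sum]
    exact Finset.sum_congr rfl fun j _ => by ring
  have h2 : ∑ i, ∑ j, T.edgeConductance r i j * (f i - f j) * g i =
      ∑ i, ∑ j, -(T.edgeConductance r i j * (f i - f j) * g j) := by
    rw [Finset.sum_comm]
    refine Finset.sum_congr rfl fun i _ => Finset.sum_congr rfl fun j _ => ?_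
    rw [T.edgeConductance_comm r j i]
    ring
  simp only [h1]
  rw [eq_div_iff (by norm_num), mul_two]
  nth_rewrite 2 [h2]
  rw [← Finset.sum_add_distrib]
  refine Finset.sum_congr rfl fun i _ => ?_
  rw [← Finset.sum_add_distrib]
  exact Finset.sum_congr rfl fun j _ => by ring

theorem sum_mul_deficitDeriv_self_nonneg {r : V → ℝ} (hr : ∀ i, 0 < r i) (f : V → ℝ) :
    0 ≤ ∑ i, f i * T.deficitDeriv r f i := by
  rw [sum_mul_deficitDeriv]
  refine div_nonneg (Finset.sum_nonneg fun i _ => Finset.sum_nonneg fun j _ => ?_) (by norm_num)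
  rw [mul_assoc]
  exact mul_nonneg (T.edgeConductance_nonneg hr i j) (mul_self_nonneg _)

variable {T} in
theorem eq_of_edgeConductance_pos {r : V → ℝ} (hr : ∀ i, 0 < r i) {f : V → ℝ}
    (hf : ∑ i, f i * T.deficitDeriv r f i = 0) {i j : V} (h : 0 < T.edgeConductance r i j) :
    f i = f j := by
  rw [sum_mul_deficitDeriv, div_eq_zero_iff, or_iff_left (by norm_num)] at hf
  have hnn : ∀ i j, 0 ≤ T.edgeConductance r i j * (f i - f j) * (f i - f j) := fun i j => by
    rw [mul_assoc]
    exact mul_nonneg (T.edgeConductance_nonneg hr i j) (mul_self_nonneg _)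
  have h1 := (Finset.sum_eq_zero_iff_of_nonneg fun i _ => Finset.sum_nonneg fun j _ => hnn i j).1
    hf i (Finset.mem_univ i)
  have h2 := (Finset.sum_eq_zero_iff_of_nonneg fun j _ => hnn i j).1 h1 j (Finset.mem_univ j)
  rw [mul_assoc, mul_eq_zero, mul_self_eq_zero] at h2
  exact sub_eq_zero.1 (h2.resolve_left h.ne')

theorem exists_isTriangle {i j : V} (h : (skeletonGraph T.complex).Adj i j) :
    ∃ k, IsTriangle T.complex i j k := by
  have hcard : ({i, j} : Finset V).card = 2 := Finset.card_pair h.1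
  obtain ⟨t, ht, htc, hsub⟩ : {t : Finset V | t ∈ T.complex ∧ t.card = 3 ∧ {i, j} ⊆ t}.Nonempty :=
    Set.nonempty_of_ncard_ne_zero (by rw [T.edge_in_two_triangles _ h.2 hcard]; norm_num)
  obtain ⟨k, hkt, hk⟩ := Finset.exists_mem_notMem_of_card_lt_card (s := {i, j}) (t := t)
    (by rw [hcard, htc]; norm_num)
  simp only [Finset.mem_insert, Finset.mem_singleton, not_or] at hk
  refine ⟨k, h.1, Ne.symm hk.2, Ne.symm hk.1, mem_complex_of_subset ht ?_ (by simp)⟩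
  intro x hx
  simp only [Finset.mem_insert, Finset.mem_singleton] at hx
  rcases hx with rfl | rfl | rfl
  exacts [hsub (by simp), hsub (by simp), hkt]

/-- The kernel of the differential of the angle deficits consists of the constant functions. -/
theorem eq_of_sum_mul_deficitDeriv_eq_zero {r : V → ℝ} (hr : ∀ i, 0 < r i) {f : V → ℝ}
    (hf : ∑ i, f i * T.deficitDeriv r f i = 0) (i j : V) : f i = f j := by
  have hadj : ∀ i j, (skeletonGraph T.complex).Adj i j → f i = f j := by
    intro i j hij
    obtain ⟨k, hk⟩ := T.exists_isTriangle hij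
    have hpos : ∀ {i j k}, IsTriangle T.complex i j k →
        T.cosWeight i j < 1 ∨ 0 < T.cosWeight j k ∨ 0 < T.cosWeight i k → f i = f j :=
      fun h hc => eq_of_edgeConductance_pos hr hf
        ((circleConductance_pos (hr _) (hr _) (hr _) (cosWeight_mem h.adj)
          (cosWeight_mem h.swap_right.adj) (cosWeight_mem h.swap_left.swap_right.adj) hc).trans_le
          (conductance_le_edgeConductance hr h))
    -- The conductance of `ij` can vanish only if the circles are tangent. Then `cos Φᵢⱼ = 1 > 0`
    -- makes the conductances of `ik` and `kj` positive, and equality passes through `k`.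
    by_cases hc : T.cosWeight i j < 1
    · exact hpos hk (.inl hc)
    · have h0 : 0 < T.cosWeight i j := by linarith
      exact (hpos hk.swap_right (.inr (.inr h0))).trans
        (hpos hk.swap_right.swap_left.swap_right (.inr (.inl (T.cosWeight_comm i j ▸ h0))))
  exact (T.connected.preconnected i j).elim fun p => by
    induction p with
    | nil => rfl
    | cons h _ ih => exact (hadj _ _ h).trans ih

end WeightedTriangulatedSurface

/-! ### Spectral gap and Poincaré inequality -/

theorem Matrix.IsHermitian.posSemidef_of_forall_neg {n : Type*} [Fintype n] [DecidableEq n]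
    {A : Matrix n n ℝ} (hA : A.IsHermitian)
    (h : ∀ μ : ℝ, μ < 0 → ∀ x : n → ℝ, A.mulVec x = μ • x → x = 0) : A.PosSemidef := by
  rw [hA.posSemidef_iff_eigenvalues_nonneg]
  intro i
  by_contra! hlt
  have h0 := h _ hlt _ (hA.mulVec_eigenvectorBasis i)
  refine hA.eigenvectorBasis.orthonormal.ne_zero i ?_
  ext j
  exact congrFun h0 j

theorem normSq_pos {V : Type*} [Fintype V] [Nonempty V] {r : V → ℝ} (hr : ∀ i, 0 < r i) :
    0 < normSq r :=
  Finset.sum_pos (fun i _ => pow_pos (hr i) 2) Finset.univ_nonempty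

namespace WeightedTriangulatedSurface

variable {V : Type*} [Fintype V] [DecidableEq V] (T : WeightedTriangulatedSurface V)

theorem sum_deficitDeriv (r f : V → ℝ) : ∑ i, T.deficitDeriv r f i = 0 := by
  have h := T.sum_mul_deficitDeriv r f fun _ => 1
  simpa using h

/-- The matrix of `D⁻¹ L D⁻¹ + (λ / ‖r‖²) r rᵀ - λ`, where `L` is the Jacobian of the angle deficits
and `D` is the diagonal matrix with entries `r`. -/
noncomputable def gapMatrix (r : V → ℝ) (lam : ℝ) : Matrix V V ℝ := fun i j =>
  ((if i = j then ∑ k, T.edgeConductance r i k else 0) - T.edgeConductance r i j) / (r i * r j) +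
    lam * (r i * r j) / normSq r - if i = j then lam else 0

theorem gapMatrix_isHermitian (r : V → ℝ) (lam : ℝ) : (T.gapMatrix r lam).IsHermitian := by
  refine Matrix.IsHermitian.ext fun i j => ?_
  simp only [gapMatrix, star_trivial]
  rw [T.edgeConductance_comm r j i, mul_comm (r j) (r i)]
  by_cases h : i = j
  · subst h; rfl
  · rw [if_neg h, if_neg h, if_neg (Ne.symm h), if_neg (Ne.symm h)]

theorem gapMatrix_mulVec {r : V → ℝ} (hr : ∀ i, 0 < r i) (lam : ℝ) (f : V → ℝ) (i : V) :
    (T.gapMatrix r lam).mulVec (fun j => r j * f j) i =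
      T.deficitDeriv r f i / r i + lam * r i * (∑ j, r j ^ 2 * f j) / normSq r -
        lam * (r i * f i) := by
  have hi := (hr i).ne'
  have h : ∀ j, T.gapMatrix r lam i j * (r j * f j) =
      (if i = j then (∑ k, T.edgeConductance r i k) * f i / r i else 0) -
        T.edgeConductance r i j * f j / r i + lam * r i / normSq r * (r j ^ 2 * f j) -
        if i = j then lam * (r i * f i) else 0 := by
    intro j
    have hj := (hr j).ne'
    rw [gapMatrix]
    split_ifs with hij
    · subst hij; field_simp
    · field_simp; ring
  simp only [Matrix.mulVec, dotProduct, h, Finset.sum_sub_distrib, Finset.sum_add_distrib,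
    Finset.sum_ite_eq, Finset.mem_univ, if_true, ← Finset.mul_sum, deficitDeriv, mul_sub,
    ← Finset.sum_mul, ← Finset.sum_div]
  ring

/-- Conjugation by `D` makes the problem symmetric, and the rank-one term lifts the constants. An
eigenvector `D f` with eigenvalue `μ < 0` would make `f` orthogonal to the constants and an
eigenvector of `-Δ` with eigenvalue `lam + μ < lam`. That number is nonnegative, is not zero since
the kernel consists of constants, and is not positive by `hlam`. -/
theorem gapMatrix_posSemidef {r : V → ℝ} (hr : ∀ i, 0 < r i) {lam : ℝ}
    (hlam : ∀ μ, 0 < μ → Module.End.HasEigenvalue (-T.laplacian r) μ → lam ≤ μ) :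
    (T.gapMatrix r lam).PosSemidef := by
  have := T.connected.nonempty
  have hN := normSq_pos hr
  refine (T.gapMatrix_isHermitian r lam).posSemidef_of_forall_neg fun μ hμ x hx => ?_
  obtain ⟨f, rfl⟩ : ∃ f : V → ℝ, (fun j => r j * f j) = x :=
    ⟨fun j => x j / r j, funext fun j => mul_div_cancel₀ _ (hr j).ne'⟩
  set s := ∑ j, r j ^ 2 * f j with hs
  have h1 : ∀ i, T.deficitDeriv r f i =
      (lam + μ) * (r i ^ 2 * f i) - lam * s / normSq r * r i ^ 2 := by
    intro i
    have h := congrFun hx i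
    rw [T.gapMatrix_mulVec hr, Pi.smul_apply, smul_eq_mul] at h
    have hi := (hr i).ne'
    have : T.deficitDeriv r f i = T.deficitDeriv r f i / r i * r i := by field_simp
    rw [this, show T.deficitDeriv r f i / r i =
      μ * (r i * f i) + lam * (r i * f i) - lam * r i * s / normSq r by linarith]
    ring
  -- Summing over the vertices removes the Jacobian term and leaves `μ s = 0`.
  have hs0 : s = 0 := by
    have h := T.sum_deficitDeriv r f
    simp only [h1, Finset.sum_sub_distrib, ← Finset.mul_sum] at h
    change (lam + μ) * s - lam * s / normSq r * normSq r = 0 at h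
    rw [div_mul_cancel₀ _ hN.ne'] at h
    have : μ * s = 0 := by linarith
    exact (mul_eq_zero.1 this).resolve_left hμ.ne
  simp only [hs0, mul_zero, zero_div, zero_mul, sub_zero] at h1
  by_contra hne
  have hf : f ≠ 0 := by
    rintro rfl
    exact hne (funext fun j => by simp)
  have hE : ∑ i, f i * T.deficitDeriv r f i = (lam + μ) * ∑ i, r i ^ 2 * f i ^ 2 := by
    rw [Finset.mul_sum]
    exact Finset.sum_congr rfl fun i _ => by rw [h1]; ring
  have hpos : 0 < ∑ i, r i ^ 2 * f i ^ 2 := by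
    obtain ⟨i, hi⟩ := Function.ne_iff.1 hf
    exact Finset.sum_pos' (fun i _ => by positivity)
      ⟨i, Finset.mem_univ i, mul_pos (pow_pos (hr i) 2) (sq_pos_of_ne_zero hi)⟩
  have hnn := T.sum_mul_deficitDeriv_self_nonneg hr f
  rw [hE] at hnn
  rcases (nonneg_of_mul_nonneg_left hnn hpos).eq_or_lt with h0 | h0
  · rw [← h0, zero_mul] at hE
    have hconst := T.eq_of_sum_mul_deficitDeriv_eq_zero hr hE
    refine hf (funext fun i => ?_)
    have : s = normSq r * f i := by
      rw [hs, normSq, Finset.sum_mul]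
      exact Finset.sum_congr rfl fun j _ => by rw [hconst i j]
    rw [hs0] at this
    exact (mul_eq_zero.1 this.symm).resolve_left hN.ne'
  · have : lam ≤ lam + μ := hlam _ h0 (Module.End.hasEigenvalue_of_hasEigenvector (x := f)
      ⟨Module.End.mem_eigenspace_iff.2 (funext fun i => by
        rw [T.neg_laplacian_apply hr, h1, Pi.smul_apply, smul_eq_mul]
        have hi := (hr i).ne'
        field_simp), hf⟩)
    linarith

/-- The Poincaré inequality for the discrete Laplacian. -/
theorem le_sum_mul_deficitDeriv {r : V → ℝ} (hr : ∀ i, 0 < r i) {lam : ℝ}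
    (hlam : ∀ μ, 0 < μ → Module.End.HasEigenvalue (-T.laplacian r) μ → lam ≤ μ) (f : V → ℝ) :
    lam * ∑ i, r i ^ 2 * f i ^ 2 - lam / normSq r * (∑ i, r i ^ 2 * f i) ^ 2 ≤
      ∑ i, f i * T.deficitDeriv r f i := by
  have h := (T.gapMatrix_posSemidef hr hlam).dotProduct_mulVec_nonneg fun j => r j * f j
  have h1 : ∀ i, r i * f i * (T.gapMatrix r lam).mulVec (fun j => r j * f j) i =
      f i * T.deficitDeriv r f i +
        lam / normSq r * (∑ j, r j ^ 2 * f j) * (r i ^ 2 * f i) - lam * (r i ^ 2 * f i ^ 2) := by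
    intro i
    have hi := (hr i).ne'
    rw [T.gapMatrix_mulVec hr]
    field_simp
  simp only [dotProduct, Pi.star_apply, star_trivial, h1, Finset.sum_sub_distrib,
    Finset.sum_add_distrib, ← Finset.mul_sum] at h
  linarith

end WeightedTriangulatedSurface

/-! ### The flow and the damped flow in logarithmic coordinates -/

theorem abs_exp_sub_one_le_mul_exp (y : ℝ) : |Real.exp y - 1| ≤ |y| * Real.exp |y| := by
  rcases le_total 0 y with hy | hy
  · rw [abs_of_nonneg hy, abs_of_nonneg (by linarith [Real.add_one_le_exp y])]
    have h := mul_le_mul_of_nonneg_left (Real.add_one_le_exp (-y)) (Real.exp_pos y).le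
    rw [← Real.exp_add, add_neg_cancel, Real.exp_zero] at h
    linarith
  · rw [abs_of_nonpos hy, abs_of_nonpos (by linarith [Real.exp_le_one_iff.2 hy])]
    have h := mul_le_mul_of_nonneg_left (Real.one_le_exp (neg_nonneg.2 hy)) (neg_nonneg.2 hy)
    linarith [Real.add_one_le_exp y]

namespace WeightedTriangulatedSurface

variable {V : Type*} [Fintype V] [DecidableEq V] (T : WeightedTriangulatedSurface V)

/-- The vector field of the normalized combinatorial Ricci flow in logarithmic coordinates. -/
noncomputable def logField (u : V → ℝ) (i : V) : ℝ :=
  2 * Real.pi * T.eulerChar / (∑ j, Real.exp (u j)) - T.logDeficit i u * Real.exp (-u i)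

/-- The Ricci flow field with prescribed squared norm `N`: the average curvature is replaced by its
value on the level set `‖r‖² = N`, and deviations from this level set are damped. -/
noncomputable def dampedField (N lam : ℝ) (u : V → ℝ) (i : V) : ℝ :=
  2 * Real.pi * T.eulerChar / N - T.logDeficit i u * Real.exp (-u i) -
    lam / N * ((∑ j, Real.exp (u j)) - N)

theorem averageCurvature_sub_rCurvature (u : V → ℝ) (i : V) :
    T.averageCurvature (expHalf u) - T.rCurvature (expHalf u) i = T.logField u i := by
  rw [averageCurvature, rCurvature, logField, normSq_expHalf, expHalf_sq, Real.exp_neg,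
    ← div_eq_mul_inv]
  rfl

theorem locallyLipschitz_logField : LocallyLipschitz T.logField := by
  have := T.connected.nonempty
  refine ContDiff.locallyLipschitz (𝕂 := ℝ) (contDiff_pi.2 fun i => ?_)
  refine (contDiff_const.div contDiff_sum_exp fun u => ?_).sub
    ((T.contDiff_logDeficit i).mul (contDiff_apply ℝ ℝ i).neg.exp)
  exact (Finset.sum_pos (fun j _ => Real.exp_pos _) Finset.univ_nonempty).ne'

theorem contDiff_dampedField (N lam : ℝ) : ContDiff ℝ 1 (T.dampedField N lam) :=
  contDiff_pi.2 fun i => (contDiff_const.sub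
    ((T.contDiff_logDeficit i).mul (contDiff_apply ℝ ℝ i).neg.exp)).sub
    (contDiff_const.mul (contDiff_sum_exp.sub contDiff_const))

theorem fderiv_dampedField (N lam : ℝ) (u w : V → ℝ) (i : V) :
    fderiv ℝ (T.dampedField N lam) u w i =
      -(T.deficitDeriv (expHalf u) w i * Real.exp (-u i)) +
        T.logDeficit i u * Real.exp (-u i) * w i - lam / N * ∑ j, Real.exp (u j) * w j := by
  have hK := ((T.contDiff_logDeficit i).differentiable one_ne_zero u).hasFDerivAt
  have hu : ∀ j : V, HasFDerivAt (fun u : V → ℝ => u j)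
      (ContinuousLinearMap.proj (R := ℝ) (φ := fun _ : V => ℝ) j) u := fun j =>
    (ContinuousLinearMap.proj (R := ℝ) (φ := fun _ : V => ℝ) j).hasFDerivAt
  have h := ((hK.mul (hu i).fun_neg.exp).const_sub (2 * Real.pi * T.eulerChar / N)).sub
    (((HasFDerivAt.fun_sum fun j (_ : j ∈ Finset.univ) => (hu j).exp).sub_const N).const_mul
      (lam / N))
  have h' := hasFDerivAt_pi'.1
    ((T.contDiff_dampedField N lam).differentiable one_ne_zero u).hasFDerivAt i
  have h2 := congrArg (fun A => A w) (h'.unique h)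
  simp only [ContinuousLinearMap.comp_apply, ContinuousLinearMap.proj_apply] at h2
  rw [h2]
  simp [fderiv_logDeficit, deficitDeriv, smul_eq_mul]
  ring

/-- Along the damped flow the squared norm is constant if it has the prescribed value initially. -/
theorem sum_exp_eq_of_dampedField {N lam : ℝ} (hN : 0 < N) {α : ℝ → V → ℝ}
    (h0 : ∑ i, Real.exp (α 0 i) = N)
    (hα : ∀ t, 0 ≤ t → HasDerivAt α (T.dampedField N lam (α t)) t) {t : ℝ} (ht : 0 ≤ t) :
    ∑ i, Real.exp (α t i) = N := by
  set R := 2 * Real.pi * T.eulerChar / N with hR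
  -- This is the scalar field governing the excess `h = ‖r‖² - N`; it vanishes at `h = 0`, so
  -- uniqueness keeps the excess zero.
  have hF : LocallyLipschitz fun h : ℝ => h * (R - lam / N * (h + N)) :=
    ContDiff.locallyLipschitz (𝕂 := ℝ) (contDiff_id.mul
      (contDiff_const.sub (contDiff_const.mul (contDiff_id.add contDiff_const))))
  have hd : ∀ s, 0 ≤ s → HasDerivAt (fun t => ∑ i, Real.exp (α t i) - N)
      ((∑ i, Real.exp (α s i) - N) * (R - lam / N * ((∑ i, Real.exp (α s i) - N) + N))) s := by
    intro s hs
    have h := (HasDerivAt.fun_sum fun i (_ : i ∈ Finset.univ) =>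
      (hasDerivAt_pi.1 (hα s hs) i).exp).sub_const N
    refine h.congr_deriv ?_
    have h1 : ∀ i, Real.exp (α s i) * T.dampedField N lam (α s) i =
        (R - lam / N * ((∑ j, Real.exp (α s j)) - N)) * Real.exp (α s i) -
          T.logDeficit i (α s) := by
      intro i
      have : Real.exp (α s i) * Real.exp (-α s i) = 1 := by rw [← Real.exp_add]; simp
      rw [dampedField, ← hR]
      linear_combination -T.logDeficit i (α s) * this
    -- Gauss-Bonnet makes the total curvature constant along the flow, which closes the equation for
    -- `h`.
    have h2 : ∑ i, T.logDeficit i (α s) = R * N := by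
      rw [hR, div_mul_cancel₀ _ hN.ne']
      exact T.sum_angleDeficit (expHalf_pos (α s))
    simp only [h1, Finset.sum_sub_distrib, ← Finset.mul_sum, h2]
    ring
  have h := hF.eqOn_Icc_of_hasDerivWithinAt (a := 0) (b := t) (g := fun _ => 0)
    (fun s hs => (hd s hs.1).continuousAt.continuousWithinAt)
    (fun s hs => (hd s hs.1).hasDerivWithinAt) continuousOn_const
    (fun s _ => by simpa using hasDerivWithinAt_const s (Set.Ici s) (0 : ℝ)) (by simp [h0])
    ⟨ht, le_rfl⟩
  exact sub_eq_zero.1 h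

variable {T} in
theorem IsRicciFlowOn.hasDerivWithinAt_log {I : Set ℝ} {ρ : ℝ → V → ℝ} (h : T.IsRicciFlowOn I ρ)
    {t : ℝ} (ht : t ∈ I) :
    HasDerivWithinAt (fun s v => Real.log (ρ s v ^ 2))
      (T.logField fun v => Real.log (ρ t v ^ 2)) I t := by
  rw [hasDerivWithinAt_pi]
  intro i
  have hpos : 0 < ρ t i ^ 2 := pow_pos (h t ht i).1 2
  refine ((h t ht i).2.log hpos.ne').congr_deriv ?_
  rw [mul_div_cancel_right₀ _ hpos.ne', ← averageCurvature_sub_rCurvature,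
    expHalf_log_sq fun i => (h t ht i).1]

variable {T} in
-- The comparison uses the undamped field, because an arbitrary solution is not known beforehand to
-- stay on the level set.
theorem IsRicciFlowOn.eqOn {b : ℝ} {ρ r : ℝ → V → ℝ} (hρ : T.IsRicciFlowOn (Set.Ico 0 b) ρ)
    (hr : T.IsRicciFlowOn (Set.Ico 0 b) r) (h0 : ρ 0 = r 0) : Set.EqOn ρ r (Set.Ico 0 b) := by
  intro t ht
  have hsub : Set.Icc 0 t ⊆ Set.Ico 0 b := fun s hs => ⟨hs.1, hs.2.trans_lt ht.2⟩
  -- The interval is a right neighbourhood of each of these points, so its derivatives are right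
  -- derivatives.
  have hmem : ∀ s ∈ Set.Ico 0 t, Set.Ico 0 b ∈ nhdsWithin s (Set.Ici s) := fun s hs =>
    Filter.mem_of_superset (Ico_mem_nhdsGE (hs.2.trans ht.2)) (Set.Ico_subset_Ico_left hs.1)
  have key := T.locallyLipschitz_logField.eqOn_Icc_of_hasDerivWithinAt (a := 0) (b := t)
    (fun s hs => ((hρ.hasDerivWithinAt_log (hsub hs)).continuousWithinAt).mono hsub)
    (fun s hs => (hρ.hasDerivWithinAt_log (hsub ⟨hs.1, hs.2.le⟩)).mono_of_mem_nhdsWithin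
      (hmem s hs))
    (fun s hs => ((hr.hasDerivWithinAt_log (hsub hs)).continuousWithinAt).mono hsub)
    (fun s hs => (hr.hasDerivWithinAt_log (hsub ⟨hs.1, hs.2.le⟩)).mono_of_mem_nhdsWithin
      (hmem s hs)) (by simp only [h0]) ⟨ht.1, le_rfl⟩
  rw [← expHalf_log_sq fun i => (hρ t ht i).1, ← expHalf_log_sq fun i => (hr t ht i).1]
  exact congrArg expHalf key

theorem isRicciFlowOn_expHalf {α : ℝ → V → ℝ} {I : Set ℝ}
    (hα : ∀ t ∈ I, HasDerivAt α (T.logField (α t)) t) :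
    T.IsRicciFlowOn I fun t => expHalf (α t) := by
  refine fun t ht i => ⟨expHalf_pos _ _, ?_⟩
  simp only [averageCurvature_sub_rCurvature, expHalf_sq]
  rw [mul_comm]
  exact (hasDerivAt_pi.1 (hα t ht) i).exp.hasDerivWithinAt

end WeightedTriangulatedSurface

/-! ### Return to the radii and conclusion -/

/-- Comparison of the Euclidean distance of two metrics with the weighted distance of their
logarithmic coordinates. -/
theorem normSq_expHalf_sub_le {V : Type*} [Fintype V] {u p : V → ℝ} {B : ℝ}
    (hB : ∀ i, |u i - p i| ≤ B) :
    normSq (WeightedTriangulatedSurface.expHalf u - WeightedTriangulatedSurface.expHalf p) ≤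
      Real.exp B / 4 * ∑ i, Real.exp (p i) * (u i - p i) ^ 2 := by
  rw [normSq, Finset.mul_sum]
  refine Finset.sum_le_sum fun i _ => ?_
  have h1 : Real.exp (u i / 2) - Real.exp (p i / 2) =
      Real.exp (p i / 2) * (Real.exp ((u i - p i) / 2) - 1) := by
    rw [mul_sub, ← Real.exp_add]
    ring_nf
  have h2 : |Real.exp ((u i - p i) / 2) - 1| ≤ |u i - p i| / 2 * Real.exp (B / 2) := by
    refine (abs_exp_sub_one_le_mul_exp _).trans ?_
    rw [abs_div, abs_two]
    have := hB i
    gcongr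
  have h3 : (Real.exp ((u i - p i) / 2) - 1) ^ 2 ≤ (u i - p i) ^ 2 / 4 * Real.exp B := by
    rw [← sq_abs]
    refine (pow_le_pow_left₀ (abs_nonneg _) h2 2).trans_eq ?_
    rw [mul_pow, div_pow, sq_abs, ← Real.exp_nat_mul]
    norm_num
    left
    ring
  rw [Pi.sub_apply]
  change (Real.exp (u i / 2) - Real.exp (p i / 2)) ^ 2 ≤ _
  rw [h1, mul_pow]
  change WeightedTriangulatedSurface.expHalf p i ^ 2 * _ ≤ _
  rw [WeightedTriangulatedSurface.expHalf_sq]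
  refine (mul_le_mul_of_nonneg_left h3 (Real.exp_pos _).le).trans_eq ?_
  ring

theorem mainTheorem6 {V : Type*} [Fintype V] [DecidableEq V]
    (T : WeightedTriangulatedSurface V) (rstar : V → ℝ)
    (hstar : T.IsConstantRCurvatureMetric rstar)
    (lam : ℝ)
    (hlam : IsLeast {μ : ℝ | 0 < μ ∧ Module.End.HasEigenvalue (-T.laplacian rstar) μ} lam)
    (hgap : 2 * Real.pi * (T.eulerChar : ℝ) / normSq rstar < lam) :
    ∃ δ > (0 : ℝ), ∃ C > (0 : ℝ), ∃ a > (0 : ℝ),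
      ∀ r₀ : V → ℝ, (∀ i, 0 < r₀ i) → normSq r₀ = normSq rstar → normSq (r₀ - rstar) < δ →
        ∃ r : ℝ → V → ℝ,
          T.IsRicciFlowOn (Set.Ici 0) r ∧ r 0 = r₀ ∧
          (∀ b > (0 : ℝ), ∀ ρ : ℝ → V → ℝ, T.IsRicciFlowOn (Set.Ico 0 b) ρ → ρ 0 = r₀ →
            Set.EqOn ρ r (Set.Ico 0 b)) ∧
          ∀ t : ℝ, 0 ≤ t → Real.sqrt (normSq (r t - rstar)) ≤ C * Real.exp (-(a * t)) := by
  classical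
  have := T.connected.nonempty
  obtain ⟨hpos, c, hc⟩ := hstar
  set N := normSq rstar with hNdef
  have hN : 0 < N := normSq_pos hpos
  set p : V → ℝ := fun v => Real.log (rstar v ^ 2) with hp
  have hexp : WeightedTriangulatedSurface.expHalf p = rstar :=
    WeightedTriangulatedSurface.expHalf_log_sq hpos
  have hexpp : ∀ i, Real.exp (p i) = rstar i ^ 2 := fun i =>
    Real.exp_log (pow_pos (hpos i) 2)
  have hK : ∀ i, T.logDeficit i p = c * rstar i ^ 2 := fun i => by
    rw [← hc i, WeightedTriangulatedSurface.rCurvature, div_mul_cancel₀ _ (pow_pos (hpos i) 2).ne',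
      WeightedTriangulatedSurface.logDeficit, hexp]
  -- Sum `Kᵢ = c rᵢ²` over the vertices and apply Gauss-Bonnet.
  have hcR : 2 * Real.pi * T.eulerChar / N = c := by
    rw [div_eq_iff hN.ne', ← T.sum_angleDeficit hpos, hNdef, normSq, Finset.mul_sum]
    exact Finset.sum_congr rfl fun i _ => by
      rw [← hK, WeightedTriangulatedSurface.logDeficit, hexp]
  have hKe : ∀ i, T.logDeficit i p * Real.exp (-p i) = c := fun i => by
    rw [hK, Real.exp_neg, hexpp, mul_inv_cancel_right₀ (pow_pos (hpos i) 2).ne']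
  have hsum : ∑ i, Real.exp (p i) = N := by simp only [hexpp]; rfl
  have hzero : T.dampedField N lam p = 0 := by
    funext i
    rw [WeightedTriangulatedSurface.dampedField, hcR, hKe, hsum]
    simp
  rw [hcR] at hgap
  obtain ⟨η, hη, hstab⟩ := exists_exponentially_stable (m := fun i => rstar i ^ 2)
    (fun i => pow_pos (hpos i) 2) ((T.contDiff_dampedField N lam).locallyLipschitz (𝕂 := ℝ)) hzero
    ((T.contDiff_dampedField N lam).differentiable one_ne_zero p).hasFDerivAt
    (sub_pos.2 hgap) (by
      intro w
      -- The defect `λ/N (∑ rᵢ² wᵢ)²` in the Poincaré inequality is exactly compensated by the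
      -- damping term.
      have hP := T.le_sum_mul_deficitDeriv hpos (fun μ h1 h2 => hlam.2 ⟨h1, h2⟩) w
      have h1 : ∀ i, rstar i ^ 2 * w i * fderiv ℝ (T.dampedField N lam) p w i =
          -(w i * T.deficitDeriv rstar w i) + c * (rstar i ^ 2 * w i ^ 2) -
            lam / N * (∑ j, rstar j ^ 2 * w j) * (rstar i ^ 2 * w i) := by
        intro i
        rw [T.fderiv_dampedField, hexp, hKe, Real.exp_neg]
        simp only [hexpp]
        have := (hpos i).ne'
        field_simp
      simp only [h1, Finset.sum_sub_distrib, Finset.sum_add_distrib, ← Finset.mul_sum,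
        Finset.sum_neg_distrib]
      linarith)
  set S := ∑ i, (rstar i ^ 2)⁻¹
  have hcont : ContinuousAt (fun r : V → ℝ =>
      ∑ i, rstar i ^ 2 * (Real.log (r i ^ 2) - p i) ^ 2) rstar := by
    refine tendsto_finsetSum _ fun i _ => ?_
    have h : ContinuousAt (fun r : V → ℝ => Real.log (r i ^ 2)) rstar :=
      ((continuous_apply i).pow 2).continuousAt.log (pow_pos (hpos i) 2).ne'
    exact ((h.sub continuousAt_const).pow 2).const_mul _
  obtain ⟨ε, hε, hεη⟩ := Metric.eventually_nhds_iff.1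
    (hcont.eventually_lt (g := fun _ => η) continuousAt_const (by simpa [hp] using hη))
  -- `B` bounds every `|uᵢ - pᵢ|` along the solution. The rate `a` is half of `lam - c`, since `lam
  -- - c` is the decay rate of a squared distance.
  set B := √(S * η)
  refine ⟨ε ^ 2, pow_pos hε 2, √(Real.exp B / 4 * η), Real.sqrt_pos.2 (by positivity),
    (lam - c) / 2, half_pos (sub_pos.2 hgap), fun r₀ hr₀ hnorm hdist => ?_⟩
  have hclose : dist r₀ rstar < ε := by
    rw [dist_pi_lt_iff hε]
    intro i
    rw [Real.dist_eq]
    refine abs_lt_of_sq_lt_sq (lt_of_le_of_lt ?_ hdist) hε.le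
    exact Finset.single_le_sum (f := fun i => (r₀ - rstar) i ^ 2) (fun j _ => sq_nonneg _)
      (Finset.mem_univ i)
  obtain ⟨α, hα0, hα⟩ := hstab (fun v => Real.log (r₀ v ^ 2)) (hεη hclose).le
  have hr0 : WeightedTriangulatedSurface.expHalf (α 0) = r₀ := by
    rw [hα0, WeightedTriangulatedSurface.expHalf_log_sq hr₀]
  have hN0 : ∑ i, Real.exp (α 0 i) = N := by
    rw [← WeightedTriangulatedSurface.normSq_expHalf, hr0, hnorm]
  have hfield : ∀ t ∈ Set.Ici (0 : ℝ), HasDerivAt α (T.logField (α t)) t := by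
    intro t ht
    refine (hα t ht).1.congr_deriv (funext fun i => ?_)
    rw [WeightedTriangulatedSurface.dampedField, WeightedTriangulatedSurface.logField,
      -- On the level set the denominator of `R_av` is `N` and the damping vanishes, so the two
      -- fields coincide.
      T.sum_exp_eq_of_dampedField hN hN0 (fun t ht => (hα t ht).1) ht]
    simp
  have hflow := T.isRicciFlowOn_expHalf hfield
  refine ⟨fun t => WeightedTriangulatedSurface.expHalf (α t), hflow, hr0,
    fun b _ ρ hρ hρ0 => hρ.eqOn ?_ (hρ0.trans hr0.symm), fun t ht => ?_⟩
  · exact T.isRicciFlowOn_expHalf fun t ht => hfield t ht.1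
  · have hQ := (hα t ht).2
    have hle1 : Real.exp (-((lam - c) * t)) ≤ 1 :=
      Real.exp_le_one_iff.2 (neg_nonpos.2 (mul_nonneg (sub_pos.2 hgap).le ht))
    have hB : ∀ i, |α t i - p i| ≤ B := by
      intro i
      refine (norm_le_pi_norm (α t - p) i).trans (Real.le_sqrt_of_sq_le ?_)
      refine (sq_norm_le_mul_sum (fun i => pow_pos (hpos i) 2) _).trans ?_
      refine mul_le_mul_of_nonneg_left (hQ.trans (mul_le_of_le_one_right hη.le hle1)) ?_
      exact Finset.sum_nonneg fun i _ => by positivity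
    have h := normSq_expHalf_sub_le hB
    simp only [hexp, hexpp] at h
    have hsq : Real.exp (-((lam - c) / 2 * t)) = √(Real.exp (-((lam - c) * t))) := by
      rw [← Real.exp_half]
      ring_nf
    rw [hsq, ← Real.sqrt_mul (by positivity)]
    refine Real.sqrt_le_sqrt (h.trans ?_)
    rw [mul_assoc]
    exact mul_le_mul_of_nonneg_left hQ (by positivity)
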